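/- Let $\mathcal I$ be a countable alphabet, $A=(a_{i,j})$ an $\mathcal I\times\mathcal I$ matrix with entries $0$ and $1$, $\Sigma=\{(i_0,i_1,\dots)\in\mathcal I^{\mathbb N}: a_{i_k,i_{k+1}}=1 \text{ for all } k\ge 0\}$ with the left shift $\sigma$ and the metric $d(x,y)=2^{-m}$, where $m$ is the first index at which $x$ and $y$ differ. Write $C(n,x)=\{z\in\Sigma: z_k=x_k,\ 0\le k\le n\}$ for the $n$-cylinder of $x\in\Sigma$. Assume that $\Sigma$ is topologically mixing: for all $a,b\in\mathcal I$ there is $N$ such that for every $n\ge N$ some $x\in\Sigma$ has $x_0=a$ and $x_n=b$. Let $\hat\mu$ be an atomless Borel probability measure on $\Sigma$ that is $\sigma$-invariant and (strongly) mixing, and let $\varphi:\Sigma\to\mathbb R$ satisfy $\varphi\in L^1(\hat\mu)$ and $\sum_{n\ge1}V_n(\varphi)<\infty$, where $V_n(\varphi)=\sup\{|\varphi(x)-\varphi(y)| : x_k=y_k,\ 0\le k\le n-1\}$. Assume that $\hat\mu$ is a local weak Gibbs measure for $\varphi$: $\hat\mu$ is positive on every nonempty cylinder, and there are $P\in\mathbb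 R$, numbers $1\le K_n\le K_{n+1}$ with $\frac1n\log K_n\to0$, and constants $c(i)\ge1$ $(i\in\mathcal I)$ such that for all $n\ge1$, $x\in\Sigma$ and $\hat\mu$-a.e. $z\in C(n-1,x)$ $$\frac1{c(x_0)K_n}\le\frac{\hat\mu(C(n-1,x))}{\exp\bigl(-nP+\sum_{j=0}^{n-1}\varphi(\sigma^jz)\bigr)}\le c(x_0)K_n .$$ Let $\hat P$ be a nonempty cylinder, $(\ell_n)$ a sequence in $\mathbb N$, and $w\in\Sigma$ a hitting point, i.e. $\sup_j c(w_{p_j})<\infty$ for some strictly increasing sequence $(p_j)$ in $\mathbb N$. Put $$W_\sigma(\hat P,\ell_n,w)=\{z\in\hat P:\ \sigma^k(z)\in C(\ell_k,w)\text{ for infinitely many }k\},\qquad \bar s=\limsup_{n\to\infty}\frac1n\log\frac1{\hat\mu(C(\ell_n,w))},$$ and assume $\bar s<\infty$. If $\sup_nK_n=\infty$, assume moreover that $\limsup_{n\to\infty}\ell_n/n<\infty$ and, when $\mathcal I$ is infinite, that $\sup\varphi<\infty$. For $\alpha\ge0$ and $E\subset\Sigma$ let $$M_\alpha(E)=\lim_{\varepsilon\to0}\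 \inf\Bigl\{\sum_i\hat\mu(F_i)^\alpha:\ E\subset\bigcup_iF_i,\ (F_i)\text{ a countable family of cylinders with }\operatorname{diam}F_i\le\varepsilon\Bigr\},$$ and $\mathrm{Dim}_{\hat\mu}(E)=\inf\{\alpha\ge0: M_\alpha(E)=0\}$. Then the Gurevich pressure $$P_G(\varphi)=\lim_{n\to\infty}\frac1n\log\sum_{\substack{x\in\Sigma,\ x_0=i\\ \sigma^n(x)=x}}\exp\Bigl(\sum_{j=0}^{n-1}\varphi(\sigma^jx)\Bigr)$$ exists, is finite and does not depend on $i\in\mathcal I$, and $$\mathrm{Dim}_{\hat\mu}\bigl(W_\sigma(\hat P,\ell_n,w)\bigr)\ \ge\ \frac{P_G(\varphi)-\int\varphi\,d\hat\mu}{P_G(\varphi)-\int\varphi\,d\hat\mu+\bar s}.$$ -/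

import Mathlib

open MeasureTheory Filter Topology
open scoped ENNReal NNReal

noncomputable section

namespace TargetBall

/-! ### Topological Markov chains -/

/-- The one-sided countable Markov shift with alphabet `I` and 0-1 transition matrix `A`; the
matrix is given as a relation, with `A i j` standing for `a_{i,j} = 1`. -/
def MarkovShift {I : Type*} (A : I → I → Prop) : Type _ :=
  {x : ℕ → I // ∀ k, A (x k) (x (k + 1))}

variable {I : Type*} {A : I → I → Prop}

instance : CoeFun (MarkovShift A) (fun _ => ℕ → I) := ⟨fun x => x.1⟩

/-- The metric `d(x,y) = 2^{-m}`, where `m` is the first index at which `x` and `y` differ. -/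
instance : MetricSpace (MarkovShift A) where
  dist x y := (PiNat.dist (E := fun _ => I)).dist x.1 y.1
  dist_self x := PiNat.dist_self x.1
  dist_comm x y := PiNat.dist_comm x.1 y.1
  dist_triangle x y z := PiNat.dist_triangle x.1 y.1 z.1
  eq_of_dist_eq_zero {x y} h := Subtype.ext (PiNat.eq_of_dist_eq_zero x.1 y.1 h)

theorem dist_eq_of_ne {x y : MarkovShift A} (h : x ≠ y) :
    dist x y = (1 / 2 : ℝ) ^ sInf {n : ℕ | x n ≠ y n} := by
  have h' : x.1 ≠ y.1 := fun e => h (Subtype.ext e)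
  have key : sInf {n : ℕ | x n ≠ y n} = PiNat.firstDiff (E := fun _ => I) x.1 y.1 := by
    apply le_antisymm
    · exact Nat.sInf_le (PiNat.apply_firstDiff_ne h')
    · by_contra hlt
      rw [not_le] at hlt
      have hne : {n : ℕ | x n ≠ y n}.Nonempty := ⟨_, PiNat.apply_firstDiff_ne h'⟩
      exact Nat.sInf_mem hne (PiNat.apply_eq_of_lt_firstDiff hlt)
  rw [key]
  exact PiNat.dist_eq_of_ne h'

instance : MeasurableSpace (MarkovShift A) := borel _

instance : BorelSpace (MarkovShift A) := ⟨rfl⟩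

/-- The left shift. -/
def shift (x : MarkovShift A) : MarkovShift A :=
  ⟨fun k => x.1 (k + 1), fun k => x.2 (k + 1)⟩

/-- The `n`-cylinder `C(n,x)`: the points sharing with `x` the symbols of index `0, …, n`. -/
def cyl (n : ℕ) (x : MarkovShift A) : Set (MarkovShift A) :=
  {z | ∀ k ≤ n, z k = x k}

/-- The family of all (nonempty) cylinders. -/
def cylinders (A : I → I → Prop) : Set (Set (MarkovShift A)) :=
  {E | ∃ (n : ℕ) (x : MarkovShift A), E = cyl n x}

/-- Topological mixing: for all symbols `a, b` and all large `n` there is an admissible word of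
length `n + 1` from `a` to `b`. -/
def TopologicallyMixing (A : I → I → Prop) : Prop :=
  ∀ a b : I, ∃ N : ℕ, ∀ n ≥ N, ∃ x : MarkovShift A, x 0 = a ∧ x n = b

/-- The target-ball set: the points `z ∈ P` with `σ^k z ∈ C(ℓ_k, w)` for infinitely many `k`. -/
def targetSet (P : Set (MarkovShift A)) (ℓ : ℕ → ℕ) (w : MarkovShift A) : Set (MarkovShift A) :=
  {z | z ∈ P ∧ ∃ᶠ k in atTop, shift^[k] z ∈ cyl (ℓ k) w}

/-! ### Carathéodory dimension -/

section Caratheodory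

variable {X : Type*} [PseudoEMetricSpace X]

/-- The premeasure at scale `ε`: the infimum of `∑ φ(F)` over the countable covers of `E` by
members of the family `𝓕` of diameter at most `ε`. -/
def caratheodoryPre (𝓕 : Set (Set X)) (φ : Set X → ℝ≥0∞) (ε : ℝ≥0∞) (E : Set X) : ℝ≥0∞ :=
  ⨅ (S : Set (Set X)) (_ : S.Countable) (_ : ∀ F ∈ S, F ∈ 𝓕 ∧ Metric.ediam F ≤ ε)
    (_ : E ⊆ ⋃₀ S), ∑' F : S, φ F

/-- Carathéodory's measure of the pair `(𝓕, φ)`: the limit of the premeasures as `ε → 0`, which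
is their supremum since they increase as `ε` decreases. -/
def caratheodoryMeasure (𝓕 : Set (Set X)) (φ : Set X → ℝ≥0∞) (E : Set X) : ℝ≥0∞ :=
  ⨆ (ε : ℝ≥0∞) (_ : 0 < ε), caratheodoryPre 𝓕 φ ε E

/-- The Carathéodory dimension `inf {α ≥ 0 : M_{𝓕,ψ^α}(E) = 0}`. -/
def caratheodoryDim (𝓕 : Set (Set X)) (ψ : Set X → ℝ≥0∞) (E : Set X) : ℝ≥0∞ :=
  ⨅ (α : ℝ≥0) (_ : caratheodoryMeasure 𝓕 (fun F => ψ F ^ (α : ℝ)) E = 0), (α : ℝ≥0∞)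

end Caratheodory

/-- The `μ`-dimension of a subset of the Markov shift. -/
def measureDim (μ : Measure (MarkovShift A)) (E : Set (MarkovShift A)) : ℝ≥0∞ :=
  caratheodoryDim (cylinders A) (fun F => μ F) E

/-! ### Potentials and Gurevich pressure -/

/-- The `n`-th variation `V_n(φ)`: the supremum of `|φ(x) - φ(y)|` over the points `x, y` sharing
the symbols of index `0, …, n - 1`. -/
def variation (φ : MarkovShift A → ℝ) (n : ℕ) : ℝ≥0∞ :=
  ⨆ (x : MarkovShift A) (y : MarkovShift A) (_ : ∀ k < n, x k = y k),
    ENNReal.ofReal |φ x - φ y|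

/-- `Z_n(φ,i)`: the sum of `exp (∑_{j<n} φ(σ^j x))` over the points `x` with `x_0 = i` and
`σ^n x = x`. -/
def partitionSum (φ : MarkovShift A → ℝ) (i : I) (n : ℕ) : ℝ≥0∞ :=
  ∑' x : {x : MarkovShift A // x 0 = i ∧ shift^[n] x = x},
    ENNReal.ofReal (Real.exp (birkhoffSum shift φ n x.1))

/-- `p` is the Gurevich pressure of `φ`: for every symbol `i`, `(1/n) log Z_n(φ,i)` converges
to `p`. -/
def IsGurevichPressure (φ : MarkovShift A → ℝ) (p : EReal) : Prop :=
  ∀ i : I, Tendsto (fun n : ℕ => ((1 / (n : ℝ) : ℝ) : EReal) * ENNReal.log (partitionSum φ i n))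
    atTop (𝓝 p)

/-! ### Local weak Gibbs measures -/

/-- `μ` is a local weak Gibbs measure for the potential `φ`, with constant `P`, sequence `K` and
local constants `c`. The two-sided bound is meant for every admissible word, so every nonempty
cylinder has positive measure; this is recorded separately because a statement about almost every
point of a null set says nothing. -/
structure IsLocalWeakGibbs (μ : Measure (MarkovShift A)) (φ : MarkovShift A → ℝ)
    (P : ℝ) (K : ℕ → ℝ) (c : I → ℝ) : Prop where
  one_le_K : ∀ n, 1 ≤ K n
  mono_K : ∀ n, K n ≤ K (n + 1)
  tendsto_K : Tendsto (fun n : ℕ => 1 / (n : ℝ) * Real.log (K n)) atTop (𝓝 0)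
  one_le_c : ∀ i, 1 ≤ c i
  pos : ∀ (n : ℕ) (x : MarkovShift A), 0 < μ (cyl n x)
  gibbs : ∀ (n : ℕ) (x : MarkovShift A), ∀ᵐ z ∂μ, z ∈ cyl n x →
    1 / (c (x 0) * K (n + 1)) ≤
        μ.real (cyl n x) / Real.exp (-((n + 1 : ℕ) : ℝ) * P + birkhoffSum shift φ (n + 1) z) ∧
      μ.real (cyl n x) / Real.exp (-((n + 1 : ℕ) : ℝ) * P + birkhoffSum shift φ (n + 1) z) ≤
        c (x 0) * K (n + 1)

/-- Strong mixing of the shift with respect to `μ`. -/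
def IsMixing (μ : Measure (MarkovShift A)) : Prop :=
  ∀ E F : Set (MarkovShift A), MeasurableSet E → MeasurableSet F →
    Tendsto (fun n : ℕ => μ (E ∩ shift^[n] ⁻¹' F)) atTop (𝓝 (μ E * μ F))

/-- `w` is a hitting point for the local constants `c`: these are bounded along the symbols of `w`
at the times of some increasing sequence. -/
def IsHittingPoint (c : I → ℝ) (w : MarkovShift A) : Prop :=
  ∃ p : ℕ → ℕ, StrictMono p ∧ BddAbove (Set.range fun j => c (w (p j)))

end TargetBall

end

open TargetBall

/-! The pressure is the Gibbs constant `P`. Points of period `n` starting at `i` correspond to the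
cylinders that partition `[i] ∩ σ⁻ⁿ[i]`, a set whose measure tends to `μ[i]² > 0` by mixing; the
Gibbs bound turns each exponential into `e^{nP}` times the measure of a cylinder, up to a
subexponential factor (`isGurevichPressure`).

Put `h = P - ∫ φ dμ` and `δ = μ[w₀]/2`, and let `α < h/(h+s)`. The weak law for `φ` and the Gibbs
bound give typical cylinders of length `n` measure at most `e^{-n(h-2ε)}`. Hence, by mixing, every
cylinder `V` contains, for a large `n`, a set `Q` of relative measure at least `δ` whose points lie
in typical cylinders and satisfy `zₙ = w₀`. Splicing `w` at time `n` into the cylinder `I` of such a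
point gives a target cylinder `J ⊆ I`, and quasi-independence together with the choice of `α` gives
`μ(V)^{α-1} μ(I) ≤ δ μ(J)^α` (`exists_step`).

Let `S` be a family of cylinders with `∑ μ(F)^α < δ μ(C)^α`, where `C` is the initial cylinder, and
let `ν = ∑ μ(F)^{α-1} μ|_F`. Suppose that `V` lies in no member of `S` and `ν(V) < δ μ(V)^α`. Then
some `J` inherits both properties: otherwise `ν(I) ≥ μ(V)^{α-1} μ(I)` for every `I`, and summing
over `Q` gives `ν(V) ≥ δ μ(V)^α` (`exists_light_child`). Iterating leads to a point that hits the
target infinitely often and is missed by `S`, so the sums over covers are bounded below. No mass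
distribution on the target set has to be built. -/

namespace TargetBall

/-! ### Weak law of large numbers for mixing maps -/

section WeakLaw

set_option linter.unusedSectionVars false

variable {X : Type*} [MeasurableSpace X] {μ : Measure X} [IsProbabilityMeasure μ] {T : X → X}

theorem integrable_comp_iterate (hT : MeasurePreserving T μ μ) {f : X → ℝ} (hf : Integrable f μ)
    (k : ℕ) : Integrable (fun x => f (T^[k] x)) μ :=
  (hT.iterate k).integrable_comp_of_integrable hf

theorem integral_comp_iterate (hT : MeasurePreserving T μ μ) {f : X → ℝ} (hf : Integrable f μ)
    (k : ℕ) : ∫ x, f (T^[k] x) ∂μ = ∫ x, f x ∂μ := by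
  have h := hT.iterate k
  conv_rhs => rw [← h.map_eq]
  rw [integral_map h.aemeasurable (by rw [h.map_eq]; exact hf.1)]

theorem integrable_birkhoffSum (hT : MeasurePreserving T μ μ) {f : X → ℝ} (hf : Integrable f μ)
    (n : ℕ) : Integrable (birkhoffSum T f n) μ :=
  integrable_finsetSum _ fun k _ => integrable_comp_iterate hT hf k

/-- The second moment of a Birkhoff sum is controlled by the autocorrelations. -/
theorem integral_birkhoffSum_sq_le (hT : MeasurePreserving T μ μ) {f : X → ℝ} (hf : Measurable f)
    {B : ℝ} (hB : ∀ x, |f x| ≤ B) (n : ℕ) :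
    ∫ x, birkhoffSum T f n x ^ 2 ∂μ ≤
      2 * n * ∑ k ∈ Finset.range n, |∫ x, f x * f (T^[k] x) ∂μ| := by
  have hm : ∀ k, Measurable fun x => f (T^[k] x) := fun k => hf.comp (hT.measurable.iterate k)
  have hprod : ∀ i j, Integrable (fun x => f (T^[i] x) * f (T^[j] x)) μ := fun i j =>
    Integrable.of_bound ((hm i).mul (hm j)).aestronglyMeasurable (B * B) (ae_of_all _ fun x => by
      rw [norm_mul]
      exact mul_le_mul (hB _) (hB _) (norm_nonneg _) ((abs_nonneg _).trans (hB x)))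
  have hcor : ∀ i k, ∫ x, f (T^[i] x) * f (T^[i + k] x) ∂μ = ∫ x, f x * f (T^[k] x) ∂μ := by
    intro i k
    rw [← integral_comp_iterate hT (f := fun x => f x * f (T^[k] x)) (by simpa using hprod 0 k) i]
    refine integral_congr_ae (ae_of_all _ fun x => ?_)
    simp only [← Function.iterate_add_apply, add_comm i k]
  set r : ℕ → ℝ := fun k => ∫ x, f x * f (T^[k] x) ∂μ with hr
  have hSm : ∀ n, Measurable (birkhoffSum T f n) := fun n =>
    Finset.measurable_fun_sum _ fun k _ => hm k
  have hSB : ∀ n x, |birkhoffSum T f n x| ≤ n * B := fun n x => by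
    refine (Finset.abs_sum_le_sum_abs _ _).trans ((Finset.sum_le_sum fun k _ => hB _).trans ?_)
    simp
  induction n with
  | zero => simp [birkhoffSum_zero]
  | succ n ih =>
    have hexp : ∀ x, birkhoffSum T f (n + 1) x ^ 2 = birkhoffSum T f n x ^ 2 +
        (2 * ∑ k ∈ Finset.range n, f (T^[k] x) * f (T^[n] x) + f (T^[n] x) * f (T^[n] x)) := by
      intro x
      rw [birkhoffSum_succ, ← Finset.sum_mul]
      change _ = _ + (2 * (birkhoffSum T f n x * _) + _)
      ring
    have hsq : Integrable (fun x => birkhoffSum T f n x ^ 2) μ :=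
      Integrable.of_bound ((hSm n).pow_const 2).aestronglyMeasurable ((n * B) ^ 2)
        (ae_of_all _ fun x => by
          rw [norm_pow]; exact pow_le_pow_left₀ (norm_nonneg _) (hSB n x) 2)
    have hsum : Integrable (fun x => ∑ k ∈ Finset.range n, f (T^[k] x) * f (T^[n] x)) μ :=
      integrable_finsetSum _ fun k _ => hprod k n
    simp_rw [hexp]
    have hrest : Integrable (fun x => 2 * ∑ k ∈ Finset.range n, f (T^[k] x) * f (T^[n] x)
        + f (T^[n] x) * f (T^[n] x)) μ := (hsum.const_mul 2).add (hprod n n)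
    rw [integral_add hsq hrest,
      integral_add (hsum.const_mul 2) (hprod n n), integral_const_mul,
      integral_finsetSum _ fun k _ => hprod k n]
    have h1 : ∑ k ∈ Finset.range n, ∫ x, f (T^[k] x) * f (T^[n] x) ∂μ
        = ∑ k ∈ Finset.range n, r (k + 1) := by
      rw [← Finset.sum_range_reflect]
      refine Finset.sum_congr rfl fun k hk => ?_
      rw [Finset.mem_range] at hk
      -- The correlation of the times `n - 1 - k` and `n` depends only on the lag `k + 1`.
      have := hcor (n - 1 - k) (k + 1)
      rwa [show n - 1 - k + (k + 1) = n by omega] at this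
    have h2 : ∫ x, f (T^[n] x) * f (T^[n] x) ∂μ = r 0 := by simpa [hr] using hcor n 0
    have h3 : ∑ k ∈ Finset.range n, r (k + 1) + r 0 ≤ ∑ k ∈ Finset.range (n + 1), |r k| := by
      rw [← Finset.sum_range_succ']
      exact Finset.sum_le_sum fun k _ => le_abs_self _
    -- The diagonal term occurs once in the expansion but twice in the doubled bound; its sign
    -- allows the extra copy to be added.
    have h4 : 0 ≤ r 0 := integral_nonneg fun x => by simpa using mul_self_nonneg (f x)
    have h5 : ∑ k ∈ Finset.range n, |r k| ≤ ∑ k ∈ Finset.range (n + 1), |r k| :=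
      Finset.sum_le_sum_of_subset_of_nonneg (by simp) fun _ _ _ => abs_nonneg _
    rw [h1, h2]
    push_cast
    have h6 : 2 * (n : ℝ) * ∑ k ∈ Finset.range n, |r k|
        ≤ 2 * n * ∑ k ∈ Finset.range (n + 1), |r k| := by gcongr
    change _ ≤ 2 * n * ∑ k ∈ Finset.range n, |r k| at ih
    change _ ≤ 2 * ((n : ℝ) + 1) * ∑ k ∈ Finset.range (n + 1), |r k|
    linarith

/-- The variance of `|f|` is nonnegative. -/
theorem sq_integral_abs_le {f : X → ℝ} (hf : Measurable f) {B : ℝ} (hB : ∀ x, |f x| ≤ B) :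
    (∫ x, |f x| ∂μ) ^ 2 ≤ ∫ x, f x ^ 2 ∂μ := by
  have h1 : Integrable (fun x => |f x|) μ :=
    Integrable.of_bound hf.abs.aestronglyMeasurable B (ae_of_all _ fun x => by simpa using hB x)
  have h2 : Integrable (fun x => f x ^ 2) μ :=
    Integrable.of_bound (hf.pow_const 2).aestronglyMeasurable (B ^ 2) (ae_of_all _ fun x => by
      rw [norm_pow]; exact pow_le_pow_left₀ (norm_nonneg _) (hB x) 2)
  set m := ∫ x, |f x| ∂μ with hm
  have h3 : 0 ≤ ∫ x, (f x ^ 2 - 2 * m * |f x| + m ^ 2) ∂μ := integral_nonneg fun x => by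
    have : f x ^ 2 - 2 * m * |f x| + m ^ 2 = (|f x| - m) ^ 2 := by rw [← sq_abs (f x)]; ring
    simp only [this]
    positivity
  have h4 : Integrable (fun x => f x ^ 2 - 2 * m * |f x|) μ := h2.sub (h1.const_mul _)
  rw [integral_add h4 (integrable_const _),
    integral_sub h2 (h1.const_mul _), integral_const_mul, ← hm] at h3
  simp at h3
  nlinarith

/-- The mean deviation of the Birkhoff averages from the space average tends to zero. -/
def MeanErgodic (μ : Measure X) (T : X → X) (f : X → ℝ) : Prop :=
  Tendsto (fun n : ℕ => (∫ x, |birkhoffSum T f n x - n * ∫ y, f y ∂μ| ∂μ) / n) atTop (𝓝 0)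

theorem birkhoffSum_sub_const (f : X → ℝ) (a : ℝ) (n : ℕ) (x : X) :
    birkhoffSum T (fun y => f y - a) n x = birkhoffSum T f n x - n * a := by
  simp [birkhoffSum]

theorem MeanErgodic.add {f g : X → ℝ} (hT : MeasurePreserving T μ μ) (hf : Integrable f μ)
    (hg : Integrable g μ) (h : MeanErgodic μ T f) (h' : MeanErgodic μ T g) :
    MeanErgodic μ T (f + g) := by
  have h0 := Tendsto.add h h'
  rw [add_zero] at h0
  refine squeeze_zero (fun n => by positivity) (fun n => ?_) h0
  rw [← add_div]
  refine div_le_div_of_nonneg_right ?_ n.cast_nonneg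
  have i1 := ((integrable_birkhoffSum hT hf n).sub (integrable_const (n * ∫ y, f y ∂μ))).abs
  have i2 := ((integrable_birkhoffSum hT hg n).sub (integrable_const (n * ∫ y, g y ∂μ))).abs
  have i3 := ((integrable_birkhoffSum hT (hf.add hg) n).sub
    (integrable_const (n * ∫ y, (f + g) y ∂μ))).abs
  refine (integral_mono i3 (i1.add i2) fun x => ?_).trans (integral_add i1 i2).le
  have e : ∫ y, (f + g) y ∂μ = ∫ y, f y ∂μ + ∫ y, g y ∂μ := integral_add hf hg
  simp only [Pi.sub_apply, Pi.add_apply, birkhoffSum_add'] at e ⊢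
  rw [e]
  refine le_trans (le_of_eq ?_) (abs_add_le _ _)
  congr 1
  ring

/-- For the centred indicator, mixing says exactly that the autocorrelations tend to zero. So do
their Cesàro means, which bound the second moment of the Birkhoff average; this moment dominates the
square of the mean deviation. -/
theorem meanErgodic_indicator (hT : MeasurePreserving T μ μ)
    (hmix : ∀ E F : Set X, MeasurableSet E → MeasurableSet F →
      Tendsto (fun n : ℕ => μ (E ∩ T^[n] ⁻¹' F)) atTop (𝓝 (μ E * μ F)))
    (a : ℝ) {E : Set X} (hE : MeasurableSet E) :
    MeanErgodic μ T (E.indicator fun _ => a) := by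
  set g : X → ℝ := E.indicator fun _ => a with hg
  have hgm : Measurable g := measurable_const.indicator hE
  set m := ∫ y, g y ∂μ with hm
  have hm' : m = μ.real E * a := by simp [hm, hg, integral_indicator hE]
  set f : X → ℝ := fun x => g x - m with hf
  have hfm : Measurable f := hgm.sub_const m
  have hgB : ∀ x, |g x| ≤ |a| := fun x => by
    by_cases hx : x ∈ E <;> simp [hg, hx]
  have hfB : ∀ x, |f x| ≤ |a| + |m| := fun x => (abs_sub _ _).trans (add_le_add_left (hgB x) _)
  have hgi : Integrable g μ := Integrable.of_bound hgm.aestronglyMeasurable |a| (ae_of_all _ hgB)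
  have hr : Tendsto (fun k : ℕ => ∫ x, f x * f (T^[k] x) ∂μ) atTop (𝓝 0) := by
    have key : ∀ k : ℕ, ∫ x, f x * f (T^[k] x) ∂μ
        = a ^ 2 * (μ.real (E ∩ T^[k] ⁻¹' E) - μ.real E * μ.real E) := by
      intro k
      have hEk : MeasurableSet (E ∩ T^[k] ⁻¹' E) := hE.inter (hT.measurable.iterate k hE)
      have e1 : ∀ x, f x * f (T^[k] x) = (E ∩ T^[k] ⁻¹' E).indicator (fun _ => a ^ 2) x
          - m * g x - m * g (T^[k] x) + m ^ 2 := by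
        intro x
        by_cases h1 : x ∈ E <;> by_cases h2 : T^[k] x ∈ E <;> simp [hf, hg, h1, h2] <;> ring
      have hgk := integrable_comp_iterate hT hgi k
      have hi : Integrable ((E ∩ T^[k] ⁻¹' E).indicator (fun _ => a ^ 2)) μ :=
        (integrable_const _).indicator hEk
      simp_rw [e1]
      have hi2 : Integrable (fun x => (E ∩ T^[k] ⁻¹' E).indicator (fun _ => a ^ 2) x - m * g x) μ :=
        hi.sub (hgi.const_mul m)
      have hi3 : Integrable (fun x => (E ∩ T^[k] ⁻¹' E).indicator (fun _ => a ^ 2) x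
          - m * g x - m * g (T^[k] x)) μ := hi2.sub (hgk.const_mul m)
      rw [integral_add hi3 (integrable_const _),
        integral_sub hi2 (hgk.const_mul m), integral_sub hi (hgi.const_mul m),
        integral_const_mul, integral_const_mul, integral_comp_iterate hT hgi k, ← hm,
        integral_indicator hEk]
      simp
      rw [hm']
      ring
    simp_rw [key]
    have h1 : Tendsto (fun k : ℕ => μ.real (E ∩ T^[k] ⁻¹' E)) atTop (𝓝 (μ.real E * μ.real E)) := by
      have := (ENNReal.tendsto_toReal (by finiteness)).comp (hmix E E hE hE)
      simpa [Measure.real, ENNReal.toReal_mul, Function.comp_def] using this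
    simpa using (h1.sub_const (μ.real E * μ.real E)).const_mul (a ^ 2)
  have hces := (Filter.Tendsto.cesaro hr.abs).const_mul 2
  simp only [abs_zero, mul_zero] at hces
  have hsq := hces.sqrt
  rw [Real.sqrt_zero] at hsq
  refine squeeze_zero (fun n => by positivity) (fun n => ?_) hsq
  rcases Nat.eq_zero_or_pos n with rfl | hn
  · simp
  refine Real.le_sqrt_of_sq_le ?_
  have hn' : (0 : ℝ) < n := by exact_mod_cast hn
  have hSm : Measurable (birkhoffSum T f n) :=
    Finset.measurable_fun_sum _ fun k _ => hfm.comp (hT.measurable.iterate k)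
  have h1 := sq_integral_abs_le (μ := μ) hSm (B := n * (|a| + |m|)) fun x => by
    refine (Finset.abs_sum_le_sum_abs _ _).trans ((Finset.sum_le_sum fun k _ => hfB _).trans ?_)
    simp [mul_add]
  have h2 := h1.trans (integral_birkhoffSum_sq_le hT hfm hfB n)
  simp_rw [hf, birkhoffSum_sub_const] at h2
  rw [div_pow, div_le_iff₀ (by positivity)]
  refine h2.trans (le_of_eq ?_)
  simp only [hf]
  field_simp

/-- Mean ergodicity passes to `L¹` limits, because replacing `f` by `g` changes the mean deviation
by at most `2‖f - g‖₁`, uniformly in `n`. The indicators and their finite sums are dense. -/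
theorem meanErgodic_of_mixing (hT : MeasurePreserving T μ μ)
    (hmix : ∀ E F : Set X, MeasurableSet E → MeasurableSet F →
      Tendsto (fun n : ℕ => μ (E ∩ T^[n] ⁻¹' F)) atTop (𝓝 (μ E * μ F)))
    {f : X → ℝ} (hf : Integrable f μ) : MeanErgodic μ T f := by
  rw [MeanErgodic, Metric.tendsto_atTop]
  intro ε hε
  obtain ⟨g, hfg, hg, hgM⟩ := MemLp.induction_dense (μ := μ) ENNReal.one_ne_top
    (fun g : X → ℝ => Integrable g μ ∧ MeanErgodic μ T g)
    (fun a E hE _ η _ => ⟨E.indicator fun _ => a, by simp,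
      (integrable_const a).indicator hE, meanErgodic_indicator hT hmix a hE⟩)
    (fun f g hf hg => ⟨hf.1.add hg.1, hf.2.add hT hf.1 hg.1 hg.2⟩)
    (fun f hf => hf.1.1) (memLp_one_iff_integrable.2 hf)
    (ε := ENNReal.ofReal (ε / 4)) (by simpa using hε)
  have hd : ∫ x, |f x - g x| ∂μ ≤ ε / 4 := by
    rw [eLpNorm_one_eq_lintegral_enorm] at hfg
    have := ENNReal.toReal_mono ENNReal.ofReal_ne_top hfg
    rw [ENNReal.toReal_ofReal (by positivity), ← integral_norm_eq_lintegral_enorm (hf.sub hg).1]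
      at this
    exact this
  have hdi : Integrable (fun x => f x - g x) μ := hf.sub hg
  obtain ⟨N, hN⟩ := (Metric.tendsto_atTop.1 hgM) (ε / 4) (by positivity)
  refine ⟨max N 1, fun n hn => ?_⟩
  have hNn := hN n (le_of_max_le_left hn)
  have hn0 : (0 : ℝ) < n := by exact_mod_cast (le_of_max_le_right hn)
  rw [Real.dist_eq, sub_zero, abs_of_nonneg (by positivity), div_lt_iff₀ hn0] at hNn ⊢
  have i1 := ((integrable_birkhoffSum hT hg n).sub (integrable_const (n * ∫ y, g y ∂μ))).abs
  have i2 := integrable_birkhoffSum hT hdi.abs n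
  have i3 := ((integrable_birkhoffSum hT hf n).sub (integrable_const (n * ∫ y, f y ∂μ))).abs
  have i4 : Integrable (fun _ : X => n * ∫ y, |f y - g y| ∂μ) μ := integrable_const _
  have e2 : ∫ x, birkhoffSum T (fun y => |f y - g y|) n x ∂μ = n * ∫ y, |f y - g y| ∂μ := by
    simp only [birkhoffSum]
    rw [integral_finsetSum _ fun k _ => integrable_comp_iterate hT hdi.abs k]
    rw [Finset.sum_congr rfl fun k _ => integral_comp_iterate hT hdi.abs k]
    simp
  have hle := integral_mono i3 ((i1.add i2).add i4) fun x => ?_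
  · have e3 := integral_add (i1.add i2) i4
    have e4 := integral_add i1 i2
    simp only [Pi.sub_apply, Pi.add_apply] at hle e3 e4
    rw [e3, e4] at hle
    rw [e2] at hle
    simp at hle
    nlinarith
  · have b1 : |birkhoffSum T f n x - birkhoffSum T g n x| ≤
        birkhoffSum T (fun y => |f y - g y|) n x := by
      simp only [birkhoffSum, ← Finset.sum_sub_distrib]
      exact Finset.abs_sum_le_sum_abs _ _
    have b2 : |n * ∫ y, f y ∂μ - n * ∫ y, g y ∂μ| ≤ n * ∫ y, |f y - g y| ∂μ := by
      rw [← mul_sub, abs_mul, abs_of_pos hn0, ← integral_sub hf hg]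
      gcongr
      exact abs_integral_le_integral_abs
    simp only [Pi.sub_apply, Pi.add_apply]
    rw [abs_le] at b1 b2 ⊢
    have := abs_le.1 (le_refl |birkhoffSum T g n x - n * ∫ y, g y ∂μ|)
    constructor <;> linarith [b1.1, b1.2, b2.1, b2.2, this.1, this.2]

/-- The weak law of large numbers for mixing transformations. -/
theorem tendsto_measure_lt_birkhoffSum (hT : MeasurePreserving T μ μ)
    (hmix : ∀ E F : Set X, MeasurableSet E → MeasurableSet F →
      Tendsto (fun n : ℕ => μ (E ∩ T^[n] ⁻¹' F)) atTop (𝓝 (μ E * μ F)))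
    {f : X → ℝ} (hf : Integrable f μ) {ε : ℝ} (hε : 0 < ε) :
    Tendsto (fun n : ℕ => μ {x | n * (∫ y, f y ∂μ + ε) ≤ birkhoffSum T f n x}) atTop (𝓝 0) := by
  have h := (meanErgodic_of_mixing hT hmix hf).div_const ε
  rw [zero_div] at h
  have h' := ENNReal.tendsto_ofReal h
  rw [ENNReal.ofReal_zero] at h'
  refine tendsto_of_tendsto_of_tendsto_of_le_of_le' tendsto_const_nhds h'
    (Eventually.of_forall fun _ => zero_le) ?_
  filter_upwards [eventually_gt_atTop 0] with n hn
  have hn0 : (0 : ℝ) < n := by exact_mod_cast hn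
  have i3 := ((integrable_birkhoffSum hT hf n).sub (integrable_const (n * ∫ y, f y ∂μ))).abs
  have hM := mul_meas_ge_le_integral_of_nonneg (ae_of_all _ fun x => abs_nonneg _) i3 (n * ε)
  rw [← ofReal_measureReal]
  refine ENNReal.ofReal_le_ofReal ?_
  rw [div_div, le_div_iff₀ (by positivity), mul_comm]
  refine le_trans ?_ hM
  refine mul_le_mul_of_nonneg_left (measureReal_mono fun x hx => ?_) (by positivity)
  rw [Set.mem_ofPred_eq] at hx ⊢
  refine le_trans ?_ (le_abs_self _)
  simp only [Pi.sub_apply]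
  linarith

end WeakLaw

/-! ### Combinatorics of cylinders -/

section Cylinders

variable {I : Type*} {A : I → I → Prop}

theorem mem_cyl_self (n : ℕ) (x : MarkovShift A) : x ∈ cyl n x := fun _ _ => rfl

theorem cyl_eq_of_mem {n : ℕ} {x z : MarkovShift A} (h : z ∈ cyl n x) : cyl n z = cyl n x := by
  ext y
  exact forall₂_congr fun k hk => by rw [h k hk]

theorem cyl_anti {m n : ℕ} (h : m ≤ n) (x : MarkovShift A) : cyl n x ⊆ cyl m x :=
  fun _ hz k hk => hz k (hk.trans h)

theorem cyl_subset_of_mem {m n : ℕ} (h : m ≤ n) {x z : MarkovShift A} (hz : z ∈ cyl m x) :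
    cyl n z ⊆ cyl m x :=
  (cyl_anti h z).trans (cyl_eq_of_mem hz).subset

theorem cylinders_nested {F G : Set (MarkovShift A)} (hF : F ∈ cylinders A) (hG : G ∈ cylinders A)
    (h : (F ∩ G).Nonempty) : F ⊆ G ∨ G ⊆ F := by
  obtain ⟨a, x, rfl⟩ := hF
  obtain ⟨b, y, rfl⟩ := hG
  obtain ⟨z, hx, hy⟩ := h
  rw [← cyl_eq_of_mem hx, ← cyl_eq_of_mem hy]
  rcases le_total a b with hab | hab
  · exact Or.inr (cyl_anti hab z)
  · exact Or.inl (cyl_anti hab z)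

theorem isOpen_cyl (n : ℕ) (x : MarkovShift A) : IsOpen (cyl n x) := by
  refine Metric.isOpen_iff.2 fun z hz => ⟨(1 / 2) ^ n, by positivity, fun y hy k hk => ?_⟩
  rw [← hz k hk]
  exact PiNat.apply_eq_of_dist_lt (E := fun _ => I) (Metric.mem_ball.1 hy) hk

theorem measurableSet_cyl (n : ℕ) (x : MarkovShift A) : MeasurableSet (cyl n x) :=
  (isOpen_cyl n x).measurableSet

theorem shift_iterate_apply (n : ℕ) (z : MarkovShift A) (k : ℕ) :
    (shift^[n] z) k = z (n + k) := by
  induction n generalizing z with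
  | zero => simp
  | succ n ih =>
    rw [Function.iterate_succ_apply, ih]
    change z.1 (n + k + 1) = z.1 (n + 1 + k)
    rw [Nat.add_right_comm]

theorem exists_splice {n : ℕ} {z w : MarkovShift A} (h : z n = w 0) :
    ∃ y : MarkovShift A, y ∈ cyl n z ∧ shift^[n] y = w := by
  refine ⟨⟨fun k => if k < n then z k else w (k - n), fun k => ?_⟩, fun k hk => ?_, ?_⟩
  · dsimp only
    rcases lt_trichotomy (k + 1) n with h1 | h1 | h1
    · rw [if_pos (by omega), if_pos h1]; exact z.2 k
    · rw [if_pos (by omega), if_neg (by omega), show k + 1 - n = 0 by omega, ← h, ← h1]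
      exact z.2 k
    · rw [if_neg (by omega), if_neg (by omega), show k + 1 - n = k - n + 1 by omega]
      exact w.2 _
  · rcases hk.lt_or_eq with h1 | h1
    · exact if_pos h1
    · subst h1
      exact (if_neg (lt_irrefl k)).trans (by rw [Nat.sub_self, h])
  · refine Subtype.ext (funext fun k => ?_)
    refine (shift_iterate_apply n _ k).trans ?_
    exact (if_neg (by omega)).trans (by rw [Nat.add_sub_cancel_left])

/-- The diagonal sequence `y i i` works, since `m i ≥ i` fixes its `i`-th symbol from stage `i` on.
No compactness is involved, so the alphabet may be infinite. -/
theorem exists_mem_iInter_cyl {m : ℕ → ℕ} (hm : StrictMono m) {y : ℕ → MarkovShift A}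
    (h : ∀ k, y (k + 1) ∈ cyl (m k) (y k)) : ∃ z, ∀ k, z ∈ cyl (m k) (y k) := by
  have hmem : ∀ j k, k ≤ j → y j ∈ cyl (m k) (y k) := by
    intro j k hkj
    induction j, hkj using Nat.le_induction with
    | base => exact mem_cyl_self _ _
    | succ j hkj ih => exact cyl_subset_of_mem (hm.monotone hkj) ih (h j)
  have key : ∀ k i, i ≤ m k → y i i = y k i := by
    intro k i hi
    rcases le_total k i with hki | hki
    · exact hmem i k hki i hi
    · exact (hmem k i hki i (hm.id_le i)).symm
  refine ⟨⟨fun i => y i i, fun i => ?_⟩, fun k i hi => key k i hi⟩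
  have h1 := hm.id_le (i + 1)
  simp only [id_eq] at h1
  change A ((y i).1 i) ((y (i + 1)).1 (i + 1))
  have h2 : (y i).1 i = (y (i + 1)).1 i := key (i + 1) i (by omega)
  rw [h2]
  exact (y (i + 1)).2 i

/-- A comparison of two measures on the `n`-cylinders inside a union of `n`-cylinders gives the
comparison on the union. -/
theorem mul_measure_le_of_cyl [Countable I] {μ ν : Measure (MarkovShift A)} {n : ℕ}
    {Q : Set (MarkovShift A)} {κ : ℝ≥0∞} (hQ : ∀ z ∈ Q, cyl n z ⊆ Q)
    (h : ∀ z ∈ Q, κ * μ (cyl n z) ≤ ν (cyl n z)) : κ * μ Q ≤ ν Q := by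
  -- Indexing by words keeps the partition countable; words that do not occur in `Q` give empty
  -- pieces.
  set piece : (Fin (n + 1) → I) → Set (MarkovShift A) :=
    fun u => {z | z ∈ Q ∧ ∀ k : Fin (n + 1), z k = u k} with hpiece
  have hcyl : ∀ u, ∀ z ∈ piece u, piece u = cyl n z := by
    rintro u z ⟨hzQ, hzu⟩
    ext y
    constructor
    · rintro ⟨-, hy⟩ k hk
      have h1 := hzu ⟨k, by omega⟩
      have h2 := hy ⟨k, by omega⟩
      exact h2.trans h1.symm
    · intro hy
      exact ⟨hQ z hzQ hy, fun k => (hy k (by omega)).trans (hzu k)⟩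
  have hmeas : ∀ u, MeasurableSet (piece u) := by
    intro u
    rcases (piece u).eq_empty_or_nonempty with h0 | ⟨z, hz⟩
    · rw [h0]; exact MeasurableSet.empty
    · rw [hcyl u z hz]; exact measurableSet_cyl n z
  have hdisj : Pairwise (Function.onFun Disjoint piece) := by
    intro u v huv
    refine Set.disjoint_left.2 fun z hu hv => huv ?_
    funext k
    exact (hu.2 k).symm.trans (hv.2 k)
  have hU : Q = ⋃ u, piece u := by
    ext z
    simp only [Set.mem_iUnion]
    exact ⟨fun hz => ⟨fun k => z k, hz, fun _ => rfl⟩, fun ⟨_, hz⟩ => hz.1⟩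
  rw [hU, measure_iUnion hdisj hmeas, measure_iUnion hdisj hmeas, ← ENNReal.tsum_mul_left]
  refine ENNReal.tsum_le_tsum fun u => ?_
  rcases (piece u).eq_empty_or_nonempty with h0 | ⟨z, hz⟩
  · simp [h0]
  · rw [hcyl u z hz]
    exact h z hz.1

end Cylinders

/-! ### Descent through lightly charged cylinders -/

section Descent

variable {I : Type*} {A : I → I → Prop}

/-- The measure `∑_{F ∈ S} μ(F)^{α-1} μ|_F` attached to a family `S` of sets. -/
noncomputable def coverMeasure (μ : Measure (MarkovShift A)) (S : Set (Set (MarkovShift A)))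
    (α : ℝ) : Measure (MarkovShift A) :=
  Measure.sum fun F : S => (μ F) ^ (α - 1) • μ.restrict F

theorem rpow_sub_one_mul_self {a : ℝ≥0∞} (h0 : a ≠ 0) (ht : a ≠ ⊤) (α : ℝ) :
    a ^ (α - 1) * a = a ^ α := by
  conv_lhs => rw [← ENNReal.rpow_one a, ← ENNReal.rpow_mul, one_mul, ← ENNReal.rpow_add _ _ h0 ht]
  congr 1
  ring

theorem coverMeasure_univ {μ : Measure (MarkovShift A)} [IsFiniteMeasure μ]
    (hpos : ∀ n x, 0 < μ (cyl (A := A) n x)) {S : Set (Set (MarkovShift A))}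
    (hS : S ⊆ cylinders A) (α : ℝ) :
    coverMeasure μ S α Set.univ = ∑' F : S, μ F ^ α := by
  rw [coverMeasure, Measure.sum_apply _ MeasurableSet.univ]
  refine tsum_congr fun F => ?_
  obtain ⟨n, x, hF⟩ := hS F.2
  simp only [Measure.smul_apply, Measure.restrict_apply_univ, smul_eq_mul]
  exact rpow_sub_one_mul_self (by rw [hF]; exact (hpos n x).ne') (measure_ne_top _ _) α

theorem le_coverMeasure {μ : Measure (MarkovShift A)} {S : Set (Set (MarkovShift A))} (α : ℝ)
    {F : Set (MarkovShift A)} (hF : F ∈ S) {B : Set (MarkovShift A)} (hB : MeasurableSet B) :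
    μ F ^ (α - 1) * μ (B ∩ F) ≤ coverMeasure μ S α B := by
  rw [coverMeasure, Measure.sum_apply _ hB]
  refine le_trans (le_of_eq ?_) (ENNReal.le_tsum (⟨F, hF⟩ : S))
  simp [Measure.restrict_apply hB]

/-- For `α ≤ 1` the density `μ(F)^{α-1}` of the cover measure is larger on smaller cylinders. -/
theorem rpow_sub_one_anti {a b : ℝ≥0∞} (h : a ≤ b) {α : ℝ} (hα : α ≤ 1) :
    b ^ (α - 1) ≤ a ^ (α - 1) := by
  rw [← neg_sub 1 α, ENNReal.rpow_neg, ENNReal.rpow_neg]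
  exact ENNReal.inv_le_inv.2 (ENNReal.rpow_le_rpow h (by linarith))

/-- One step of the descent: a cylinder that is lightly charged by the cover has a lightly charged
child. -/
theorem exists_light_child [Countable I] {μ : Measure (MarkovShift A)} [IsFiniteMeasure μ]
    (hpos : ∀ n x, 0 < μ (cyl (A := A) n x)) {α : ℝ} (hα0 : 0 ≤ α) (hα1 : α ≤ 1)
    {δ : ℝ≥0∞} (hδ : δ ≤ 1) {S : Set (Set (MarkovShift A))} (hS : S ⊆ cylinders A)
    {m n l : ℕ} {v : MarkovShift A} {Q : Set (MarkovShift A)} (hQV : Q ⊆ cyl m v)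
    (hQ : ∀ z ∈ Q, cyl n z ⊆ Q) (hμQ : δ * μ (cyl m v) ≤ μ Q) {p : MarkovShift A → MarkovShift A}
    (hp : ∀ z ∈ Q, p z ∈ cyl n z)
    (hJ : ∀ z ∈ Q, μ (cyl m v) ^ (α - 1) * μ (cyl n z) ≤ δ * μ (cyl (n + l) (p z)) ^ α)
    (hV : ∀ F ∈ S, ¬ cyl m v ⊆ F)
    (hlight : coverMeasure μ S α (cyl m v) < δ * μ (cyl m v) ^ α) :
    ∃ z ∈ Q, (∀ F ∈ S, ¬ cyl (n + l) (p z) ⊆ F) ∧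
      coverMeasure μ S α (cyl (n + l) (p z)) < δ * μ (cyl (n + l) (p z)) ^ α := by
  by_contra hcon
  push Not at hcon
  have hne : ∀ n x, μ (cyl (A := A) n x) ≠ 0 := fun n x => (hpos n x).ne'
  -- Write `V`, `I`, `J` for the cylinders of `v`, `z`, `p z`. If some `F ∈ S` contains `J`, then `F
  -- ⊆ V`. When `F ⊆ I`, its whole mass `μ(F)^α ≥ δ μ(J)^α` lies in `I`; when `I ⊆ F`, its density
  -- on `I` is at least `μ(V)^{α-1}`. If no member contains `J`, the contradiction hypothesis makes
  -- `J` heavy.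
  have key : ∀ z ∈ Q, μ (cyl m v) ^ (α - 1) * μ (cyl n z) ≤ coverMeasure μ S α (cyl n z) := by
    intro z hz
    have hJI : cyl (n + l) (p z) ⊆ cyl n z := cyl_subset_of_mem (Nat.le_add_right n l) (hp z hz)
    have hIV : cyl n z ⊆ cyl m v := (hQ z hz).trans hQV
    by_cases hF : ∃ F ∈ S, cyl (n + l) (p z) ⊆ F
    · obtain ⟨F, hFS, hJF⟩ := hF
      have hpF : p z ∈ F := hJF (mem_cyl_self _ _)
      have hFV : F ⊆ cyl m v := by
        rcases cylinders_nested (hS hFS) ⟨m, v, rfl⟩ ⟨p z, hpF, hIV (hp z hz)⟩ with h | h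
        · exact h
        · exact absurd h (hV F hFS)
      rcases cylinders_nested (hS hFS) ⟨n, z, rfl⟩ ⟨p z, hpF, hp z hz⟩ with h | h
      · refine (hJ z hz).trans ?_
        have h1 := le_coverMeasure (μ := μ) α hFS (measurableSet_cyl n z)
        rw [Set.inter_eq_right.2 h, rpow_sub_one_mul_self ?_ (measure_ne_top _ _)] at h1
        · calc δ * μ (cyl (n + l) (p z)) ^ α ≤ 1 * μ F ^ α := by gcongr
            _ ≤ _ := by rwa [one_mul]
        · exact fun h0 => hne _ _ (measure_mono_null hJF h0)
      · have h1 := le_coverMeasure (μ := μ) α hFS (measurableSet_cyl n z)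
        rw [Set.inter_eq_left.2 h] at h1
        refine le_trans ?_ h1
        gcongr ?_ * _
        exact rpow_sub_one_anti (measure_mono hFV) hα1
    · push Not at hF
      exact (hJ z hz).trans ((hcon z hz hF).trans (measure_mono hJI))
  have h1 := mul_measure_le_of_cyl hQ key
  have h2 : δ * μ (cyl m v) ^ α ≤ coverMeasure μ S α (cyl m v) := by
    refine le_trans ?_ (h1.trans (measure_mono hQV))
    rw [← rpow_sub_one_mul_self (hne m v) (measure_ne_top _ _), mul_left_comm]
    gcongr
  exact absurd hlight (not_lt.2 h2)

/-- If inside every cylinder the target is hit by cylinders that are large enough, then light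
families of cylinders do not cover the target set. -/
theorem not_targetSet_subset_of_step [Countable I] {μ : Measure (MarkovShift A)} [IsFiniteMeasure μ]
    (hpos : ∀ n x, 0 < μ (cyl (A := A) n x)) {α : ℝ} (hα0 : 0 ≤ α) (hα1 : α ≤ 1)
    {δ : ℝ≥0∞} (hδ : δ ≤ 1) {N : ℕ} {x w : MarkovShift A} {ℓ : ℕ → ℕ}
    (hstep : ∀ m, ∀ v ∈ cyl N x, N ≤ m → ∃ n > m, ∃ Q ⊆ cyl m v, (∀ z ∈ Q, cyl n z ⊆ Q) ∧
      δ * μ (cyl m v) ≤ μ Q ∧ ∀ z ∈ Q, ∃ y ∈ cyl n z, shift^[n] y = w ∧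
        μ (cyl m v) ^ (α - 1) * μ (cyl n z) ≤ δ * μ (cyl (n + ℓ n) y) ^ α)
    {S : Set (Set (MarkovShift A))} (hS : S ⊆ cylinders A)
    (hsum : ∑' F : S, μ F ^ α < δ * μ (cyl N x) ^ α) :
    ¬ targetSet (cyl N x) ℓ w ⊆ ⋃₀ S := by
  let St := {q : ℕ × MarkovShift A // (q.2 ∈ cyl N x ∧ N ≤ q.1) ∧ (∀ F ∈ S, ¬ cyl q.1 q.2 ⊆ F) ∧
    coverMeasure μ S α (cyl q.1 q.2) < δ * μ (cyl q.1 q.2) ^ α}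
  have hnext : ∀ q : St, ∃ q' : St, q.1.1 < q'.1.1 ∧ q'.1.2 ∈ cyl q.1.1 q.1.2 ∧
      ∃ n > q.1.1, q'.1.1 = n + ℓ n ∧ shift^[n] q'.1.2 = w := by
    rintro ⟨⟨m, v⟩, ⟨hv, hm⟩, hV, hlight⟩
    obtain ⟨n, hn, Q, hQV, hQ, hμQ, hy⟩ := hstep m v hv hm
    have : ∀ z, ∃ y, z ∈ Q → y ∈ cyl n z ∧ shift^[n] y = w ∧
        μ (cyl m v) ^ (α - 1) * μ (cyl n z) ≤ δ * μ (cyl (n + ℓ n) y) ^ α := by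
      intro z
      by_cases hz : z ∈ Q
      · obtain ⟨y, h⟩ := hy z hz
        exact ⟨y, fun _ => h⟩
      · exact ⟨z, fun h => absurd h hz⟩
    choose p hp using this
    obtain ⟨z, hz, h1, h2⟩ := exists_light_child hpos hα0 hα1 hδ hS hQV hQ hμQ
      (fun z hz => (hp z hz).1) (fun z hz => (hp z hz).2.2) hV hlight
    have hpV : p z ∈ cyl m v := hQV (hQ z hz (hp z hz).1)
    exact ⟨⟨⟨n + ℓ n, p z⟩, ⟨cyl_subset_of_mem hm hv hpV, hm.trans (by omega)⟩, h1, h2⟩,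
      by change m < n + ℓ n; omega, hpV, n, hn, rfl, (hp z hz).2.1⟩
  -- A member containing the initial cylinder would by itself exceed the allowed sum.
  have hinit : ∀ F ∈ S, ¬ cyl N x ⊆ F := by
    intro F hF hsub
    refine absurd hsum (not_lt.2 ?_)
    calc δ * μ (cyl N x) ^ α ≤ 1 * μ F ^ α := by gcongr
      _ = μ F ^ α := one_mul _
      _ ≤ _ := ENNReal.le_tsum (f := fun F : S => μ (F : Set (MarkovShift A)) ^ α) ⟨F, hF⟩
  let q0 : St := ⟨⟨N, x⟩, ⟨mem_cyl_self _ _, le_rfl⟩, hinit,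
    (measure_mono (Set.subset_univ _)).trans_lt ((coverMeasure_univ hpos hS α).trans_lt hsum)⟩
  choose nx hnx using hnext
  let q : ℕ → St := fun k => nx^[k] q0
  have hq : ∀ k, q (k + 1) = nx (q k) := fun k => Function.iterate_succ_apply' nx k q0
  have hmono : StrictMono fun k => (q k).1.1 :=
    strictMono_nat_of_lt_succ fun k => by rw [hq]; exact (hnx (q k)).1
  obtain ⟨z, hz⟩ := exists_mem_iInter_cyl hmono (y := fun k => (q k).1.2)
    fun k => by rw [hq]; exact (hnx (q k)).2.1
  intro hcov
  have hzT : z ∈ targetSet (cyl N x) ℓ w := by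
    refine ⟨hz 0, Filter.frequently_atTop.2 fun a => ?_⟩
    obtain ⟨n, hn, hn1, hn2⟩ := (hnx (q a)).2.2
    have ha := hmono.id_le a
    simp only [id_eq] at ha
    -- Stage `a + 1` fixes the symbols up to `n + ℓ n`, with a hitting time `n` larger than the
    -- level of stage `a`, hence larger than `a`.
    refine ⟨n, by omega, fun k hk => ?_⟩
    have h1 := hz (a + 1)
    rw [hq] at h1
    rw [shift_iterate_apply, ← hn2, shift_iterate_apply]
    exact h1 _ (by omega)
  obtain ⟨F, hFS, hzF⟩ := hcov hzT
  obtain ⟨b, u, hF⟩ := hS hFS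
  -- A member of level `b` containing the limit point would contain the cylinder of stage `b`, whose
  -- level is at least `b`.
  refine (q b).2.2.1 F hFS ?_
  have hb := hmono.id_le b
  simp only [id_eq] at hb
  rw [← cyl_eq_of_mem (hz b), hF]
  exact cyl_subset_of_mem hb (hF ▸ hzF)

end Descent

/-! ### Gibbs estimates -/

section Gibbs

variable {I : Type*} {A : I → I → Prop} {μ : Measure (MarkovShift A)} {φ : MarkovShift A → ℝ}
  {P : ℝ} {K : ℕ → ℝ} {c : I → ℝ}

theorem exists_mem_of_ae {X : Type*} [MeasurableSpace X] {μ : Measure X} {B : Set X}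
    (hB : μ B ≠ 0) {p : X → Prop} (h : ∀ᵐ z ∂μ, p z) : ∃ z ∈ B, p z := by
  by_contra! hcon
  exact hB (measure_mono_null hcon h)

/-- Bounded distortion: after `j` shifts the points still share `n + 1 - j` symbols, so the
differences are dominated by distinct terms of the series of variations. -/
theorem abs_birkhoffSum_sub_le (hVar : ∑' n : ℕ, variation φ (n + 1) < ⊤) {n : ℕ}
    {x z : MarkovShift A} (hz : z ∈ cyl n x) :
    |birkhoffSum shift φ (n + 1) z - birkhoffSum shift φ (n + 1) x| ≤
      (∑' n : ℕ, variation φ (n + 1)).toReal := by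
  rw [← ENNReal.ofReal_le_iff_le_toReal hVar.ne, birkhoffSum, birkhoffSum,
    ← Finset.sum_sub_distrib]
  calc ENNReal.ofReal |∑ j ∈ Finset.range (n + 1), (φ (shift^[j] z) - φ (shift^[j] x))|
      ≤ ENNReal.ofReal (∑ j ∈ Finset.range (n + 1), |φ (shift^[j] z) - φ (shift^[j] x)|) :=
        ENNReal.ofReal_le_ofReal (Finset.abs_sum_le_sum_abs _ _)
    _ = ∑ j ∈ Finset.range (n + 1), ENNReal.ofReal |φ (shift^[j] z) - φ (shift^[j] x)| :=
        ENNReal.ofReal_sum_of_nonneg fun _ _ => abs_nonneg _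
    _ ≤ ∑ j ∈ Finset.range (n + 1), variation φ (n + 1 - 1 - j + 1) := by
        refine Finset.sum_le_sum fun j hj => ?_
        rw [Finset.mem_range] at hj
        refine le_iSup_of_le (shift^[j] z) (le_iSup_of_le (shift^[j] x) (le_iSup_of_le ?_ le_rfl))
        intro k hk
        rw [shift_iterate_apply, shift_iterate_apply]
        exact hz _ (by omega)
    _ = ∑ k ∈ Finset.range (n + 1), variation φ (k + 1) :=
        Finset.sum_range_reflect (fun k => variation φ (k + 1)) (n + 1)
    _ ≤ _ := ENNReal.sum_le_tsum _

theorem IsLocalWeakGibbs.exp_le (h : IsLocalWeakGibbs μ φ P K c) (n : ℕ) (x : MarkovShift A) :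
    ∀ᵐ z ∂μ, z ∈ cyl n x → Real.exp (-((n + 1 : ℕ) : ℝ) * P + birkhoffSum shift φ (n + 1) z) ≤
      c (x 0) * K (n + 1) * μ.real (cyl n x) := by
  filter_upwards [h.gibbs n x] with z hz hzx
  have h1 := (hz hzx).1
  have hcK : 0 < c (x 0) * K (n + 1) :=
    mul_pos (one_pos.trans_le (h.one_le_c _)) (one_pos.trans_le (h.one_le_K _))
  rw [div_le_div_iff₀ hcK (Real.exp_pos _), one_mul] at h1
  linarith

theorem IsLocalWeakGibbs.le_exp (h : IsLocalWeakGibbs μ φ P K c) (n : ℕ) (x : MarkovShift A) :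
    ∀ᵐ z ∂μ, z ∈ cyl n x → μ.real (cyl n x) ≤ c (x 0) * K (n + 1) *
      Real.exp (-((n + 1 : ℕ) : ℝ) * P + birkhoffSum shift φ (n + 1) z) := by
  filter_upwards [h.gibbs n x] with z hz hzx
  exact (div_le_iff₀ (Real.exp_pos _)).1 (hz hzx).2

/-- The exceptional null set may depend on the cylinder, but there are only countably many cylinders
of level `n`; one representative of each realised word suffices. -/
theorem ae_cyl_self [Countable I] {n : ℕ} {p : I → Set (MarkovShift A) → MarkovShift A → Prop}
    (h : ∀ x : MarkovShift A, ∀ᵐ z ∂μ, z ∈ cyl n x → p (x 0) (cyl n x) z) :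
    ∀ᵐ z ∂μ, p (z 0) (cyl n z) z := by
  let r : MarkovShift A → (Fin (n + 1) → I) := fun z k => z k
  have hr : ∀ u : Set.range r, ∃ x, r x = u := fun u => u.2
  choose f hf using hr
  filter_upwards [ae_all_iff.2 fun u => h (f u)] with z hz
  have hmem : z ∈ cyl n (f ⟨r z, z, rfl⟩) := fun k hk =>
    (congrFun (hf ⟨r z, z, rfl⟩) ⟨k, by omega⟩).symm
  have h1 := hz _ hmem
  rwa [← cyl_eq_of_mem hmem, ← hmem 0 (Nat.zero_le n)] at h1

theorem IsLocalWeakGibbs.tendsto_log_K (h : IsLocalWeakGibbs μ φ P K c) :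
    Tendsto (fun n : ℕ => Real.log (K n) / n) atTop (𝓝 0) :=
  h.tendsto_K.congr fun n => by ring

theorem IsLocalWeakGibbs.tendsto_log_K_succ (h : IsLocalWeakGibbs μ φ P K c) :
    Tendsto (fun n : ℕ => Real.log (K (n + 1)) / n) atTop (𝓝 0) := by
  have h1 := h.tendsto_log_K.comp (tendsto_add_atTop_nat 1)
  have h2 : Tendsto (fun n : ℕ => 1 + 1 / (n : ℝ)) atTop (𝓝 (1 + 0)) :=
    tendsto_one_div_atTop_nhds_zero_nat.const_add 1
  have h3 := h1.mul h2
  rw [zero_mul] at h3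
  refine h3.congr' ?_
  filter_upwards [eventually_gt_atTop 0] with n hn
  have hn0 : (n : ℝ) ≠ 0 := by exact_mod_cast hn.ne'
  simp only [Function.comp_apply]
  push_cast
  field_simp

/-- A Gibbs measure is quasi-independent from below on concatenated words. -/
theorem IsLocalWeakGibbs.mul_le_of_splice [IsProbabilityMeasure μ]
    (h : IsLocalWeakGibbs μ φ P K c)
    (hInv : MeasurePreserving shift μ μ) {n l : ℕ} {y z w : MarkovShift A} (hy : y ∈ cyl n z)
    (hw : shift^[n + 1] y = w) :
    μ.real (cyl n z) * μ.real (cyl l w) ≤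
      (c (z 0) * K (n + 1)) * (c (w 0) * K (l + 1)) * (c (z 0) * K (n + 1 + l + 1)) *
        μ.real (cyl (n + 1 + l) y) := by
  -- Invariance pulls the almost sure bound for the second word back along `σ^{n+1}`. All three
  -- bounds can then be taken at one point `u`, where Birkhoff sums add exactly and no distortion
  -- appears.
  have h3 := (hInv.iterate (n + 1)).quasiMeasurePreserving.ae (h.le_exp l w)
  obtain ⟨u, hu, ⟨h1, h2⟩, h3⟩ := exists_mem_of_ae (h.pos (n + 1 + l) y).ne'
    (((h.exp_le (n + 1 + l) y).and (h.le_exp n z)).and h3)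
  have hyz : y 0 = z 0 := hy 0 (Nat.zero_le n)
  have hun : u ∈ cyl n z := fun k hk => (hu k (by omega)).trans (hy k hk)
  have huw : shift^[n + 1] u ∈ cyl l w := fun k hk => by
    rw [← hw, shift_iterate_apply, shift_iterate_apply]
    exact hu _ (by omega)
  specialize h1 hu
  specialize h2 hun
  specialize h3 huw
  rw [hyz] at h1
  have hc : ∀ i, 0 < c i := fun i => one_pos.trans_le (h.one_le_c i)
  have hK : ∀ i, 0 < K i := fun i => one_pos.trans_le (h.one_le_K i)
  have hE : Real.exp (-((n + 1 : ℕ) : ℝ) * P + birkhoffSum shift φ (n + 1) u) *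
      Real.exp (-((l + 1 : ℕ) : ℝ) * P + birkhoffSum shift φ (l + 1) (shift^[n + 1] u)) =
      Real.exp (-((n + 1 + l + 1 : ℕ) : ℝ) * P + birkhoffSum shift φ (n + 1 + l + 1) u) := by
    rw [← Real.exp_add, add_assoc (n + 1) l 1, birkhoffSum_add _ _ (n + 1) (l + 1)]
    congr 1
    push_cast
    linarith
  have hcz := hc (z 0)
  have hcw := hc (w 0)
  have hK1 := hK (n + 1)
  have hK2 := hK (l + 1)
  calc μ.real (cyl n z) * μ.real (cyl l w) ≤ _ := mul_le_mul h2 h3 measureReal_nonneg (by positivity)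
    _ = (c (z 0) * K (n + 1)) * (c (w 0) * K (l + 1)) *
        Real.exp (-((n + 1 + l + 1 : ℕ) : ℝ) * P + birkhoffSum shift φ (n + 1 + l + 1) u) := by
      rw [← hE]; ring
    _ ≤ (c (z 0) * K (n + 1)) * (c (w 0) * K (l + 1)) *
        (c (z 0) * K (n + 1 + l + 1) * μ.real (cyl (n + 1 + l) y)) := by gcongr
    _ = _ := by ring

end Gibbs

/-! ### Identification of the Gurevich pressure -/

section Pressure

variable {I : Type*} {A : I → I → Prop} {μ : Measure (MarkovShift A)} {φ : MarkovShift A → ℝ}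
  {P : ℝ} {K : ℕ → ℝ} {c : I → ℝ}

theorem apply_mod_of_periodic {n : ℕ} {x : MarkovShift A} (hx : shift^[n] x = x) (k : ℕ) :
    x (k % n) = x k := by
  have hp : Function.Periodic x.1 n := fun k => by
    rw [add_comm]
    refine (shift_iterate_apply n x k).symm.trans ?_
    rw [hx]
  exact hp.map_mod_nat k

/-- The word `y₀ … y_{n-1}` can be repeated because `yₙ = y₀` makes the closing transition
admissible. -/
theorem exists_periodic {n : ℕ} (hn : 0 < n) {y : MarkovShift A} (hy : y n = y 0) :
    ∃ x : MarkovShift A, shift^[n] x = x ∧ y ∈ cyl n x := by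
  refine ⟨⟨fun k => y (k % n), fun k => ?_⟩, Subtype.ext (funext fun k => ?_), fun k hk => ?_⟩
  · have hlt := Nat.mod_lt k hn
    have h1 := y.2 (k % n)
    change A (y.1 (k % n)) (y.1 ((k + 1) % n))
    rcases Nat.lt_or_ge (k % n + 1) n with h2 | h2
    · rwa [Nat.add_mod_eq_add_mod_right 1 (Nat.mod_mod k n).symm, Nat.mod_eq_of_lt h2]
    · have h3 : k % n + 1 = n := by omega
      rw [Nat.add_mod_eq_add_mod_right 1 (Nat.mod_mod k n).symm, h3, Nat.mod_self]
      rw [h3] at h1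
      rwa [← (show y.1 n = y.1 0 from hy)]
  · refine (shift_iterate_apply n _ k).trans ?_
    change y.1 ((n + k) % n) = y.1 (k % n)
    rw [Nat.add_mod_left]
  · change y.1 k = y.1 (k % n)
    rcases hk.lt_or_eq with h1 | rfl
    · rw [Nat.mod_eq_of_lt h1]
    · rw [Nat.mod_self]; exact hy

/-- The `n`-cylinders of the points of period `n` starting at `i` partition the set of points
that start at `i` and return to `i` at time `n`. -/
theorem tsum_measure_cyl_periodic [Countable I] {n : ℕ}
    (hn : 0 < n) {i : I} {a : MarkovShift A} (ha : a 0 = i) :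
    ∑' x : {x : MarkovShift A // x 0 = i ∧ shift^[n] x = x}, μ (cyl n x.1) =
      μ (cyl 0 a ∩ shift^[n] ⁻¹' cyl 0 a) := by
  have hinj : ∀ x y : {x : MarkovShift A // x 0 = i ∧ shift^[n] x = x},
      (∀ k ≤ n, x.1 k = y.1 k) → x = y := by
    intro x y hxy
    refine Subtype.ext (Subtype.ext (funext fun k => ?_))
    rw [← apply_mod_of_periodic x.2.2 k, ← apply_mod_of_periodic y.2.2 k]
    exact hxy _ (Nat.mod_lt k hn).le
  have : Countable {x : MarkovShift A // x 0 = i ∧ shift^[n] x = x} := by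
    refine Function.Injective.countable
      (f := fun x => (fun k => x.1 k : Fin (n + 1) → I)) fun x y hxy => hinj x y fun k hk => ?_
    exact congrFun hxy ⟨k, by omega⟩
  refine (measure_iUnion (f := fun x : {x : MarkovShift A // x 0 = i ∧ shift^[n] x = x} =>
    cyl n x.1) ?_ fun x => measurableSet_cyl n x.1).symm.trans ?_
  rotate_left
  · congr 1
    ext z
    simp only [Set.mem_iUnion]
    constructor
    · rintro ⟨x, hx⟩
      have h0 : z 0 = i := (hx 0 (Nat.zero_le n)).trans x.2.1
      have h1 : z n = i := by
        rw [hx n le_rfl, ← apply_mod_of_periodic x.2.2, Nat.mod_self]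
        exact x.2.1
      refine ⟨fun k hk => ?_, fun k hk => ?_⟩ <;> obtain rfl : k = 0 := by omega
      · rw [h0, ha]
      · rw [shift_iterate_apply, ha, ← h1]; rfl
    · rintro ⟨h0, h1⟩
      have e0 : z 0 = i := (h0 0 le_rfl).trans ha
      have e1 : z n = i := by
        have := h1 0 le_rfl
        rw [shift_iterate_apply] at this
        exact this.trans ha
      obtain ⟨x, hx, hzx⟩ := exists_periodic hn (e1.trans e0.symm)
      exact ⟨⟨x, (hzx 0 (Nat.zero_le n)).symm.trans e0, hx⟩, hzx⟩
  · intro x y hxy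
    refine Set.disjoint_left.2 fun z hx hy => hxy (hinj x y fun k hk => ?_)
    exact (hx k hk).symm.trans (hy k hk)

theorem IsLocalWeakGibbs.exp_birkhoffSum_bounds [IsProbabilityMeasure μ]
    (h : IsLocalWeakGibbs μ φ P K c) (hVar : ∑' n : ℕ, variation φ (n + 1) < ⊤)
    (a : MarkovShift A) :
    ∃ B : ℝ, ∀ (n : ℕ) (x : MarkovShift A), x 0 = a 0 → shift^[n] x = x →
      Real.exp (birkhoffSum shift φ n x) ≤
        Real.exp (n * P + (B + Real.log (K (n + 1)))) * μ.real (cyl n x) ∧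
      Real.exp (n * P - (B + Real.log (K (n + 1)))) * μ.real (cyl n x) ≤
        Real.exp (birkhoffSum shift φ n x) := by
  set D := (∑' n : ℕ, variation φ (n + 1)).toReal with hD
  -- The `n`-cylinder has `n + 1` symbols, against a period of `n`. One `D` is the distortion
  -- between `z` and `x`; the other `D`, with `|φ a|` and `|P|`, pays for the extra term.
  refine ⟨2 * D + |φ a| + |P| + Real.log (c (a 0)), fun n x hx0 hx => ?_⟩
  obtain ⟨z, hz, h1, h2⟩ := exists_mem_of_ae (h.pos n x).ne' ((h.exp_le n x).and (h.le_exp n x))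
  have hc : 0 < c (a 0) := one_pos.trans_le (h.one_le_c _)
  have hK : 0 < K (n + 1) := one_pos.trans_le (h.one_le_K _)
  specialize h1 hz
  specialize h2 hz
  have hS := abs_le.1 (abs_birkhoffSum_sub_le hVar hz)
  rw [birkhoffSum_succ _ _ n x, hx] at hS
  have hφ := abs_birkhoffSum_sub_le hVar (n := 0) (x := a) (z := x) fun k hk => by
    obtain rfl : k = 0 := by omega
    exact hx0
  rw [zero_add, birkhoffSum_one, birkhoffSum_one] at hφ
  have hφ' := abs_le.1 hφ
  have ha := abs_le.1 (le_refl |φ a|)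
  have hP := abs_le.1 (le_refl |P|)
  rw [hx0, ← Real.exp_log hc, ← Real.exp_log hK, ← Real.exp_add] at h1 h2
  push_cast at h1 h2
  constructor
  · calc Real.exp (birkhoffSum shift φ n x)
        ≤ Real.exp (n * P + (2 * D + |φ a| + |P|)) *
          Real.exp (-(n + 1 : ℝ) * P + birkhoffSum shift φ (n + 1) z) := by
          rw [← Real.exp_add]
          exact Real.exp_le_exp.2 (by linarith)
      _ ≤ Real.exp (n * P + (2 * D + |φ a| + |P|)) *
          (Real.exp (Real.log (c (a 0)) + Real.log (K (n + 1))) * μ.real (cyl n x)) := by gcongr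
      _ = _ := by rw [← mul_assoc, ← Real.exp_add]; congr 2; ring
  · calc _ ≤ Real.exp (n * P - (2 * D + |φ a| + |P| + Real.log (c (a 0)) + Real.log (K (n + 1)))) *
          (Real.exp (Real.log (c (a 0)) + Real.log (K (n + 1))) *
            Real.exp (-(n + 1 : ℝ) * P + birkhoffSum shift φ (n + 1) z)) := by gcongr
      _ ≤ _ := by
          rw [← Real.exp_add, ← Real.exp_add]
          exact Real.exp_le_exp.2 (by linarith)

theorem IsLocalWeakGibbs.isGurevichPressure [Countable I] [IsProbabilityMeasure μ]
    (h : IsLocalWeakGibbs μ φ P K c) (hVar : ∑' n : ℕ, variation φ (n + 1) < ⊤)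
    (hMix : IsMixing μ)
    (hA : TopologicallyMixing A) : IsGurevichPressure φ (P : EReal) := by
  intro i
  obtain ⟨M, hM⟩ := hA i i
  obtain ⟨a, ha, -⟩ := hM M le_rfl
  obtain ⟨B, hB⟩ := h.exp_birkhoffSum_bounds hVar a
  set r : ℕ → ℝ := fun n => μ.real (cyl 0 a ∩ shift^[n] ⁻¹' cyl 0 a) with hr
  have hr0 : 0 < μ.real (cyl 0 a) := ENNReal.toReal_pos (h.pos 0 a).ne' (measure_ne_top _ _)
  have hrt : Tendsto r atTop (𝓝 (μ.real (cyl 0 a) * μ.real (cyl 0 a))) := by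
    have := (ENNReal.tendsto_toReal (by finiteness)).comp
      (hMix _ _ (measurableSet_cyl 0 a) (measurableSet_cyl 0 a))
    simpa [hr, Measure.real, ENNReal.toReal_mul, Function.comp_def] using this
  -- The return probabilities have a positive limit, so they do not contribute to the exponential
  -- rate.
  have hlog : Tendsto (fun n : ℕ => Real.log (r n) / n) atTop (𝓝 0) := by
    have h1 := hrt.log (mul_pos hr0 hr0).ne'
    simpa [div_eq_mul_inv] using h1.mul tendsto_inv_atTop_nhds_zero_nat
  have hB0 : Tendsto (fun n : ℕ => B / n) atTop (𝓝 0) := tendsto_const_div_atTop_nhds_zero_nat B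
  have hup : Tendsto (fun n : ℕ => P + (B / n + Real.log (K (n + 1)) / n) + Real.log (r n) / n)
      atTop (𝓝 P) := by
    simpa using ((hB0.add h.tendsto_log_K_succ).const_add P).add hlog
  have hlo : Tendsto (fun n : ℕ => P - (B / n + Real.log (K (n + 1)) / n) + Real.log (r n) / n)
      atTop (𝓝 P) := by
    simpa using ((hB0.add h.tendsto_log_K_succ).const_sub P).add hlog
  have hcont := continuous_coe_real_ereal.tendsto P
  refine tendsto_of_tendsto_of_tendsto_of_le_of_le' (hcont.comp hlo) (hcont.comp hup) ?_ ?_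
  all_goals
    filter_upwards [eventually_gt_atTop 0, hrt.eventually (lt_mem_nhds (mul_pos hr0 hr0))] with n hn hrn
    have hn0 : (0 : ℝ) < n := by exact_mod_cast hn
    have hsum := tsum_measure_cyl_periodic (μ := μ) hn ha
    have hn1 : (0 : EReal) ≤ ((1 / (n : ℝ) : ℝ) : EReal) := by
      exact_mod_cast (by positivity : (0 : ℝ) ≤ 1 / n)
    have hof : ∀ u : ℝ, ∑' x : {x : MarkovShift A // x 0 = i ∧ shift^[n] x = x},
        ENNReal.ofReal (Real.exp u * μ.real (cyl n x.1)) = ENNReal.ofReal (Real.exp u * r n) := by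
      intro u
      rw [ENNReal.ofReal_mul (Real.exp_nonneg u), ofReal_measureReal, ← hsum,
        ← ENNReal.tsum_mul_left]
      refine tsum_congr fun x => ?_
      rw [ENNReal.ofReal_mul (Real.exp_nonneg u), ofReal_measureReal]
    have hval : ∀ u : ℝ, ((1 / (n : ℝ) : ℝ) : EReal) * ENNReal.log (ENNReal.ofReal
        (Real.exp u * r n)) = ((u / n + Real.log (r n) / n : ℝ) : EReal) := by
      intro u
      rw [ENNReal.log_ofReal_of_pos (by positivity), Real.log_mul (Real.exp_ne_zero _) hrn.ne',
        Real.log_exp, ← EReal.coe_mul]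
      congr 1
      ring
  · have e : P - (B / n + Real.log (K (n + 1)) / n) = (n * P - (B + Real.log (K (n + 1)))) / n := by
      field_simp
    rw [Function.comp_apply, e, ← hval]
    refine mul_le_mul_of_nonneg_left (ENNReal.log_le_log ?_) hn1
    rw [← hof, partitionSum]
    exact ENNReal.tsum_le_tsum fun x =>
      ENNReal.ofReal_le_ofReal (hB n x.1 (x.2.1.trans ha.symm) x.2.2).2
  · have e : P + (B / n + Real.log (K (n + 1)) / n) = (n * P + (B + Real.log (K (n + 1)))) / n := by
      field_simp
    rw [Function.comp_apply, e, ← hval]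
    refine mul_le_mul_of_nonneg_left (ENNReal.log_le_log ?_) hn1
    rw [← hof, partitionSum]
    exact ENNReal.tsum_le_tsum fun x =>
      ENNReal.ofReal_le_ofReal (hB n x.1 (x.2.1.trans ha.symm) x.2.2).1

end Pressure

/-! ### Typical cylinders, the step of the descent, and the dimension -/

section Entropy

variable {I : Type*} {A : I → I → Prop} {μ : Measure (MarkovShift A)}
  {φ : MarkovShift A → ℝ} {P : ℝ} {K : ℕ → ℝ} {c : I → ℝ}

/-- The entropy `P - ∫ φ dμ` of a mixing weak Gibbs measure is nonnegative. -/
theorem IsLocalWeakGibbs.integral_le [Countable I] [IsProbabilityMeasure μ] (h : IsLocalWeakGibbs μ φ P K c)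
    (hInv : MeasurePreserving shift μ μ) (hMix : IsMixing μ) (hInt : Integrable φ μ)
    (a : MarkovShift A) : ∫ z, φ z ∂μ ≤ P := by
  refine le_of_forall_pos_le_add fun ε hε => ?_
  -- Applied to `-φ`, the weak law gives a point with Birkhoff sum at least about `n ∫ φ`. Staying
  -- in `cyl 0 a` fixes the local constant, and since the cylinder has measure at most one, the sum
  -- exceeds `nP` by at most `log (c K)`.
  have hw := tendsto_measure_lt_birkhoffSum hInv hMix hInt.neg (half_pos hε)
  have hc : 0 < c (a 0) := one_pos.trans_le (h.one_le_c _)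
  have hlog : Tendsto (fun n : ℕ => Real.log (c (a 0)) / n + Real.log (K n) / n) atTop (𝓝 0) := by
    simpa using (tendsto_const_div_atTop_nhds_zero_nat (Real.log (c (a 0)))).add h.tendsto_log_K
  obtain ⟨n, hn1, hn2, hn⟩ := ((hw.eventually (gt_mem_nhds (h.pos 0 a))).and
    ((hlog.eventually (gt_mem_nhds (half_pos hε))).and (eventually_gt_atTop 0))).exists
  have hn0 : (0 : ℝ) < n := by exact_mod_cast hn
  obtain ⟨k, rfl⟩ := Nat.exists_eq_succ_of_ne_zero hn.ne'
  have hae : ∀ᵐ z ∂μ, Real.exp (-((k + 1 : ℕ) : ℝ) * P + birkhoffSum shift φ (k + 1) z) ≤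
      c (z 0) * K (k + 1) * μ.real (cyl k z) :=
    ae_cyl_self (p := fun i F z => Real.exp (-((k + 1 : ℕ) : ℝ) * P +
      birkhoffSum shift φ (k + 1) z) ≤ c i * K (k + 1) * μ.real F) (h.exp_le k)
  have hpos : μ (cyl 0 a \ {x | ((k + 1 : ℕ) : ℝ) * (∫ y, (-φ) y ∂μ + ε / 2) ≤
      birkhoffSum shift (-φ) (k + 1) x}) ≠ 0 := fun h0 => by
    have h1 := measure_le_inter_add_sdiff μ (cyl 0 a) {x | ((k + 1 : ℕ) : ℝ) *
      (∫ y, (-φ) y ∂μ + ε / 2) ≤ birkhoffSum shift (-φ) (k + 1) x}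
    rw [h0, add_zero] at h1
    exact absurd (h1.trans (measure_mono Set.inter_subset_right)) (not_le.2 hn1)
  obtain ⟨z, ⟨hza, hz⟩, hzG⟩ := exists_mem_of_ae hpos hae
  rw [Set.mem_ofPred_eq, not_le] at hz
  have hK : 0 < K (k + 1) := one_pos.trans_le (h.one_le_K _)
  have hza0 : z 0 = a 0 := hza 0 le_rfl
  have h1 : Real.exp (-((k + 1 : ℕ) : ℝ) * P + birkhoffSum shift φ (k + 1) z) ≤
      Real.exp (Real.log (c (a 0)) + Real.log (K (k + 1))) := by
    rw [Real.exp_add (Real.log _), Real.exp_log hc, Real.exp_log hK, ← hza0]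
    refine hzG.trans (mul_le_of_le_one_right (mul_nonneg ?_ hK.le) measureReal_le_one)
    rw [hza0]
    exact hc.le
  rw [Real.exp_le_exp] at h1
  have h2 : birkhoffSum shift (-φ) (k + 1) z = -birkhoffSum shift φ (k + 1) z := by
    simp [birkhoffSum]
  have h3 : ∫ y, (-φ) y ∂μ = -∫ y, φ y ∂μ := integral_neg φ
  rw [h2, h3] at hz
  rw [← add_div, div_lt_iff₀ hn0] at hn2
  have h4 : ((k + 1 : ℕ) : ℝ) * ∫ y, φ y ∂μ ≤ ((k + 1 : ℕ) : ℝ) * (P + ε) := by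
    linarith
  exact le_of_mul_le_mul_left h4 hn0

theorem IsLocalWeakGibbs.eventually_log_K_le (h : IsLocalWeakGibbs μ φ P K c) {ℓ : ℕ → ℕ}
    (hℓ : ¬ BddAbove (Set.range K) →
      limsup (fun n : ℕ => (((ℓ n : ℝ) / n : ℝ) : EReal)) atTop < ⊤) {η : ℝ} (hη : 0 < η) :
    ∀ᶠ n : ℕ in atTop, Real.log (K (n + ℓ n + 1)) ≤ η * n := by
  have hK : ∀ n, 0 < K n := fun n => one_pos.trans_le (h.one_le_K n)
  by_cases hbdd : BddAbove (Set.range K)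
  · obtain ⟨B, hB⟩ := hbdd
    have ht : Tendsto (fun n : ℕ => η * (n : ℝ)) atTop atTop :=
      tendsto_natCast_atTop_atTop.const_mul_atTop hη
    filter_upwards [ht.eventually_ge_atTop (Real.log B)] with n hn
    exact (Real.log_le_log (hK _) (hB ⟨_, rfl⟩)).trans hn
  · obtain ⟨r, hr, -⟩ := EReal.lt_iff_exists_real_btwn.1 (hℓ hbdd)
    -- With `ℓ n < r n` and `n ≥ 1`, the factor `r + 2` absorbs `n + ℓ n + 1`.
    obtain ⟨M, hM⟩ := exists_nat_ge (max r 0 + 2)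
    have hM0 : 0 < M := by
      have : (0 : ℝ) < M := by linarith [le_max_right r 0]
      exact_mod_cast this
    have hMr : (0 : ℝ) < M := by exact_mod_cast hM0
    have ht : Tendsto (fun n : ℕ => M * n) atTop atTop := tendsto_id.const_mul_atTop' hM0
    have hmono : Monotone K := monotone_nat_of_le_succ h.mono_K
    filter_upwards [eventually_lt_of_limsup_lt hr, eventually_gt_atTop 0,
      (h.tendsto_log_K.comp ht).eventually (gt_mem_nhds (div_pos hη hMr))] with n h1 h2 h3
    have hn0 : (0 : ℝ) < n := by exact_mod_cast h2
    have hn1 : (1 : ℝ) ≤ n := by exact_mod_cast h2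
    rw [EReal.coe_lt_coe_iff, div_lt_iff₀ hn0] at h1
    have hle : n + ℓ n + 1 ≤ M * n := by
      have : ((n + ℓ n + 1 : ℕ) : ℝ) ≤ ((M * n : ℕ) : ℝ) := by
        push_cast
        nlinarith [le_max_left r 0]
      exact_mod_cast this
    simp only [Function.comp_apply] at h3
    push_cast at h3
    rw [div_lt_iff₀ (mul_pos hMr hn0)] at h3
    refine (Real.log_le_log (hK _) (hmono hle)).trans (h3.le.trans (le_of_eq ?_))
    field_simp

/-- Split `M = M^{1-α} M^α`: the first factor is small by the entropy bound, the second is compared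
with `J^α`. The gap `4ε` is what remains after the errors `2ε` in both rates, leaving a decay
`e^{-2εn}` that absorbs the dependence on `a`. -/
theorem rpow_mul_le_of_rates {α ε s h a M J δ n : ℝ} (hα0 : 0 ≤ α) (hα1 : α ≤ 1) (ha : 0 < a)
    (hM0 : 0 < M) (hM : M ≤ Real.exp (-(n * (h - 2 * ε))))
    (hJ : M * Real.exp (-(n * (s + 2 * ε))) ≤ J)
    (hδ : a ^ (α - 1) * Real.exp (-(2 * ε * n)) ≤ δ) (hgap : h - α * (h + s) = 4 * ε) :
    a ^ (α - 1) * M ≤ δ * J ^ α := by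
  have hδ0 : 0 ≤ δ := le_trans (by positivity) hδ
  have h1 : M ^ (1 - α) ≤ Real.exp (-(n * (h - 2 * ε)) * (1 - α)) := by
    rw [Real.exp_mul]
    exact Real.rpow_le_rpow hM0.le hM (by linarith)
  have h2 : M ^ α * Real.exp (-(n * (s + 2 * ε)) * α) ≤ J ^ α := by
    rw [Real.exp_mul, ← Real.mul_rpow hM0.le (Real.exp_nonneg _)]
    exact Real.rpow_le_rpow (by positivity) hJ hα0
  have h3 : M = M ^ (1 - α) * M ^ α := by
    rw [← Real.rpow_add hM0, sub_add_cancel, Real.rpow_one]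
  calc a ^ (α - 1) * M = a ^ (α - 1) * (M ^ (1 - α) * M ^ α) := by rw [← h3]
    _ ≤ a ^ (α - 1) * (Real.exp (-(n * (h - 2 * ε)) * (1 - α)) * M ^ α) := by gcongr
    _ = a ^ (α - 1) * Real.exp (-(2 * ε * n)) * (M ^ α * Real.exp (-(n * (s + 2 * ε)) * α)) := by
        have : -(n * (h - 2 * ε)) * (1 - α) = -(2 * ε * n) + -(n * (s + 2 * ε)) * α := by
          linear_combination -n * hgap
        rw [this, Real.exp_add]
        ring
    _ ≤ δ * J ^ α := by gcongr

/-- The points of a cylinder that hit the first symbol of the target at time `n` and whose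
cylinder has the typical exponential size eventually fill a definite proportion of it. -/
theorem IsLocalWeakGibbs.eventually_le_measure_typical [Countable I] [IsProbabilityMeasure μ]
    (h : IsLocalWeakGibbs μ φ P K c) (hInv : MeasurePreserving shift μ μ) (hMix : IsMixing μ)
    (hInt : Integrable φ μ) (m : ℕ) (v w : MarkovShift A) {ε : ℝ} (hε : 0 < ε) :
    ∀ᶠ k : ℕ in atTop, μ (cyl 0 w) / 2 * μ (cyl m v) ≤
      μ {z | z ∈ cyl m v ∧ μ.real (cyl k z) ≤
        Real.exp (-(((k + 1 : ℕ) : ℝ) * (P - ∫ y, φ y ∂μ - 2 * ε))) ∧ z (k + 1) = w 0} := by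
  have hc : 0 < c (v 0) := one_pos.trans_le (h.one_le_c _)
  have hbad := (tendsto_measure_lt_birkhoffSum hInv hMix hInt hε).comp (tendsto_add_atTop_nat 1)
  have hmix := (hMix _ _ (measurableSet_cyl m v) (measurableSet_cyl 0 w)).comp
    (tendsto_add_atTop_nat 1)
  have hlog : Tendsto (fun n : ℕ => Real.log (c (v 0)) / n + Real.log (K n) / n) atTop (𝓝 0) := by
    simpa using (tendsto_const_div_atTop_nhds_zero_nat (Real.log (c (v 0)))).add h.tendsto_log_K
  -- The points of `cyl m v` returning to `w₀` have limiting measure `μ(cyl m v) μ(cyl 0 w)`;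
  -- removing the atypical ones costs nothing in the limit, and half of this is kept.
  have hdiff := ENNReal.Tendsto.sub hmix hbad (Or.inr ENNReal.zero_ne_top)
  rw [tsub_zero] at hdiff
  have hlt : μ (cyl 0 w) / 2 * μ (cyl m v) < μ (cyl m v) * μ (cyl 0 w) := by
    rw [mul_comm]
    exact ENNReal.mul_lt_mul_right (h.pos _ _).ne' (measure_ne_top _ _)
      (ENNReal.half_lt_self (h.pos _ _).ne' (measure_ne_top _ _))
  filter_upwards [hdiff.eventually (lt_mem_nhds hlt),
    (hlog.comp (tendsto_add_atTop_nat 1)).eventually (gt_mem_nhds hε)] with k hk hKk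
  refine hk.le.trans (tsub_le_iff_right.2 ?_)
  refine (measure_mono_ae ?_).trans (measure_union_le _ _)
  have hae : ∀ᵐ z ∂μ, μ.real (cyl k z) ≤ c (z 0) * K (k + 1) *
      Real.exp (-((k + 1 : ℕ) : ℝ) * P + birkhoffSum shift φ (k + 1) z) :=
    ae_cyl_self (p := fun i F z => μ.real F ≤ c i * K (k + 1) *
      Real.exp (-((k + 1 : ℕ) : ℝ) * P + birkhoffSum shift φ (k + 1) z)) (h.le_exp k)
  filter_upwards [hae] with z hz
  rintro ⟨hzv, hzw⟩
  by_cases hb : ((k + 1 : ℕ) : ℝ) * (∫ y, φ y ∂μ + ε) ≤ birkhoffSum shift φ (k + 1) z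
  · exact Or.inr hb
  refine Or.inl ⟨hzv, ?_, ?_⟩
  · have hn0 : (0 : ℝ) < (k + 1 : ℕ) := by positivity
    simp only [Function.comp_apply] at hKk
    rw [← add_div, div_lt_iff₀ hn0] at hKk
    have hz0 : z 0 = v 0 := hzv 0 (Nat.zero_le m)
    rw [hz0] at hz
    refine hz.trans ?_
    rw [← Real.exp_log hc, ← Real.exp_log (one_pos.trans_le (h.one_le_K (k + 1))), ← Real.exp_add,
      ← Real.exp_add, Real.exp_le_exp]
    rw [not_le] at hb
    nlinarith
  · have := hzw 0 le_rfl
    rw [shift_iterate_apply] at this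
    exact this

/-- Inside every cylinder the target is hit, at arbitrarily large times, by cylinders that are
large enough for the exponent `α`. -/
theorem IsLocalWeakGibbs.exists_step [Countable I] [IsProbabilityMeasure μ]
    (h : IsLocalWeakGibbs μ φ P K c) (hInv : MeasurePreserving shift μ μ) (hMix : IsMixing μ)
    (hInt : Integrable φ μ) {ℓ : ℕ → ℕ} {w : MarkovShift A}
    (hℓ : ¬ BddAbove (Set.range K) →
      limsup (fun n : ℕ => (((ℓ n : ℝ) / n : ℝ) : EReal)) atTop < ⊤) {s : ℝ}
    (hs : limsup (fun n : ℕ =>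
      ((1 / (n : ℝ) * Real.log (1 / μ.real (cyl (ℓ n) w)) : ℝ) : EReal)) atTop = (s : EReal))
    {α : ℝ} (hα0 : 0 ≤ α) (hα1 : α ≤ 1)
    (hgap : α * (P - ∫ z, φ z ∂μ + s) < P - ∫ z, φ z ∂μ) (m : ℕ) (v : MarkovShift A) :
    ∃ n > m, ∃ Q ⊆ cyl m v, (∀ z ∈ Q, cyl n z ⊆ Q) ∧
      μ (cyl 0 w) / 2 * μ (cyl m v) ≤ μ Q ∧ ∀ z ∈ Q, ∃ y ∈ cyl n z, shift^[n] y = w ∧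
        μ (cyl m v) ^ (α - 1) * μ (cyl n z) ≤
          μ (cyl 0 w) / 2 * μ (cyl (n + ℓ n) y) ^ α := by
  set H := P - ∫ z, φ z ∂μ with hH
  -- A quarter of the gap in the strict inequality for `α`.
  obtain ⟨ε, hε⟩ : ∃ ε, H - α * (H + s) = 4 * ε := ⟨(H - α * (H + s)) / 4, by ring⟩
  have hε0 : 0 < ε := by linarith
  have hreal : ∀ n x, 0 < μ.real (cyl (A := A) n x) := fun n x =>
    ENNReal.toReal_pos (h.pos n x).ne' (measure_ne_top _ _)
  have hK : ∀ n, 0 < K n := fun n => one_pos.trans_le (h.one_le_K n)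
  have hc : ∀ i, 0 < c i := fun i => one_pos.trans_le (h.one_le_c i)
  have hmono : Monotone K := monotone_nat_of_le_succ h.mono_K
  set a := μ.real (cyl m v) with ha
  set C := c (v 0) * c (w 0) * c (v 0) with hC
  have hC0 : 0 < C := mul_pos (mul_pos (hc _) (hc _)) (hc _)
  have hrate : ∀ᶠ n : ℕ in atTop, ((1 / (n : ℝ) * Real.log (1 / μ.real (cyl (ℓ n) w)) : ℝ) : EReal)
      < ((s + ε : ℝ) : EReal) := by
    refine eventually_lt_of_limsup_lt ?_
    rw [hs]
    exact_mod_cast (by linarith : s < s + ε)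
  have hlin : Tendsto (fun n : ℕ => ε / 2 * (n : ℝ)) atTop atTop :=
    tendsto_natCast_atTop_atTop.const_mul_atTop (by linarith)
  have hexp : Tendsto (fun n : ℕ => a ^ (α - 1) * Real.exp (-(2 * ε * n))) atTop (𝓝 0) := by
    have h1 : Tendsto (fun n : ℕ => 2 * ε * (n : ℝ)) atTop atTop :=
      tendsto_natCast_atTop_atTop.const_mul_atTop (by linarith)
    simpa using (Real.tendsto_exp_neg_atTop_nhds_zero.comp h1).const_mul (a ^ (α - 1))
  -- The loss `e^{εn}` in quasi-independence is shared out: `ε/6` for each of the three factors `K`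
  -- and `ε/2` for the constant `C`.
  have hev := (hrate.and ((h.eventually_log_K_le hℓ (by linarith : 0 < ε / 6)).and
    ((hlin.eventually_ge_atTop (Real.log C)).and
      (hexp.eventually (gt_mem_nhds (half_pos (hreal 0 w)))))))
  obtain ⟨k, hkm, hQ, hb, hKk, hCk, hδ⟩ := ((eventually_ge_atTop m).and
    ((h.eventually_le_measure_typical hInv hMix hInt m v w hε0).and
      ((tendsto_add_atTop_nat 1).eventually hev))).exists
  refine ⟨k + 1, by omega, _, fun z hz => hz.1, ?_, hQ, ?_⟩
  · rintro z ⟨hzv, hzM, hzw⟩ u hu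
    have huz : u ∈ cyl k z := cyl_anti (Nat.le_succ k) z hu
    refine ⟨cyl_subset_of_mem hkm hzv huz, ?_, (hu _ le_rfl).trans hzw⟩
    rwa [cyl_eq_of_mem huz]
  rintro z ⟨hzv, hzM, hzw⟩
  obtain ⟨y, hyz, hyw⟩ := exists_splice hzw
  refine ⟨y, hyz, hyw, ?_⟩
  have hz0 : z 0 = v 0 := hzv 0 (Nat.zero_le m)
  have hn0 : (0 : ℝ) < (k + 1 : ℕ) := by positivity
  set n : ℕ := k + 1 with hn
  have hq := h.mul_le_of_splice (l := ℓ n) hInv (cyl_anti (Nat.le_succ k) z hyz) hyw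
  rw [hz0] at hq
  set L := K (n + ℓ n + 1) with hL
  have hq1 : μ.real (cyl k z) * μ.real (cyl (ℓ n) w) ≤
      Real.exp (ε * n) * μ.real (cyl (n + ℓ n) y) := by
    refine hq.trans ?_
    have e : (c (v 0) * K n) * (c (w 0) * K (ℓ n + 1)) * (c (v 0) * L) ≤ C * (L * L * L) := by
      calc (c (v 0) * K n) * (c (w 0) * K (ℓ n + 1)) * (c (v 0) * L)
          = C * (K n * K (ℓ n + 1) * L) := by rw [hC]; ring
        _ ≤ C * (L * L * L) := by
          have h1 : K n ≤ L := hmono (by omega)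
          have h2 : K (ℓ n + 1) ≤ L := hmono (by omega)
          have h3 := hK n
          have h4 := hK (ℓ n + 1)
          have h5 := hK (n + ℓ n + 1)
          gcongr
    refine mul_le_mul_of_nonneg_right (e.trans ?_) measureReal_nonneg
    have hL0 : 0 < L := hK _
    rw [← Real.exp_log hC0, ← Real.exp_log hL0, ← Real.exp_add, ← Real.exp_add,
      ← Real.exp_add, Real.exp_le_exp]
    linarith
  have hb1 : Real.exp (-(n * (s + ε))) ≤ μ.real (cyl (ℓ n) w) := by
    rw [EReal.coe_lt_coe_iff, one_div, inv_mul_lt_iff₀ hn0, one_div, Real.log_inv] at hb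
    rw [← Real.le_log_iff_exp_le (hreal _ _)]
    linarith
  have hJ : μ.real (cyl k z) * Real.exp (-(n * (s + 2 * ε))) ≤ μ.real (cyl (n + ℓ n) y) := by
    have e : Real.exp (-(n * (s + 2 * ε))) = Real.exp (-(ε * n)) * Real.exp (-(n * (s + ε))) := by
      rw [← Real.exp_add]
      congr 1
      ring
    calc _ = Real.exp (-(ε * n)) * (μ.real (cyl k z) * Real.exp (-(n * (s + ε)))) := by
          rw [e]; ring
      _ ≤ Real.exp (-(ε * n)) * (Real.exp (ε * n) * μ.real (cyl (n + ℓ n) y)) := by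
          refine mul_le_mul_of_nonneg_left ?_ (Real.exp_nonneg _)
          exact (mul_le_mul_of_nonneg_left hb1 measureReal_nonneg).trans hq1
      _ = _ := by rw [← mul_assoc, ← Real.exp_add]; simp
  have hfin := rpow_mul_le_of_rates (n := n) hα0 hα1 (hreal m v) (hreal k z) hzM hJ hδ.le hε
  -- The rates concern the word of length `n = k + 1`, that is `cyl k z`; the cylinder `cyl n z`,
  -- which also fixes the symbol `w₀`, is smaller.
  have hle : μ.real (cyl n z) ≤ μ.real (cyl k z) := measureReal_mono (cyl_anti (Nat.le_succ k) z)
  have hfin2 : a ^ (α - 1) * μ.real (cyl n z) ≤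
      μ.real (cyl 0 w) / 2 * μ.real (cyl (n + ℓ n) y) ^ α :=
    le_trans (mul_le_mul_of_nonneg_left hle (by positivity)) hfin
  have hE := ENNReal.ofReal_le_ofReal hfin2
  rw [ENNReal.ofReal_mul (by positivity), ENNReal.ofReal_mul (by positivity),
    ← ENNReal.ofReal_rpow_of_pos (hreal m v), ← ENNReal.ofReal_rpow_of_pos (hreal _ y),
    ENNReal.ofReal_div_of_pos two_pos, ofReal_measureReal, ofReal_measureReal, ofReal_measureReal,
    ofReal_measureReal, ENNReal.ofReal_ofNat] at hE
  exact hE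

/-- The premeasure at scale `⊤` is already at most the Carathéodory measure, so a lower bound on
sums over covers without any restriction on diameters suffices. -/
theorem le_measureDim_of_forall_not_subset {E : Set (MarkovShift A)} {d : ℝ}
    (hE : ∀ α : ℝ, 0 ≤ α → α < d → ∃ δ > 0, ∀ S ⊆ cylinders A,
      ∑' F : S, μ F ^ α < δ → ¬ E ⊆ ⋃₀ S) :
    ENNReal.ofReal d ≤ measureDim μ E := by
  refine le_iInf₂ fun α hα => ?_
  by_contra hlt
  rw [not_le, ENNReal.lt_ofReal_iff_toReal_lt ENNReal.coe_ne_top] at hlt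
  obtain ⟨δ, hδ, hS⟩ := hE α α.2 hlt
  have hpre : caratheodoryPre (cylinders A) (fun F => μ F ^ (α : ℝ)) ⊤ E < δ := by
    refine lt_of_le_of_lt ?_ hδ
    rw [← hα]
    exact le_iSup₂ (f := fun (ε : ℝ≥0∞) (_ : 0 < ε) =>
      caratheodoryPre (cylinders A) (fun F => μ F ^ (α : ℝ)) ε E) ⊤ ENNReal.zero_lt_top
  simp only [caratheodoryPre, iInf_lt_iff] at hpre
  obtain ⟨S, -, hSc, hcov, hsum⟩ := hpre
  exact hS S (fun F hF => (hSc F hF).1) hsum hcov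

end Entropy

end TargetBall

theorem mainTheorem11 {I : Type*} [Countable I] (A : I → I → Prop)
    (hA : TopologicallyMixing A)
    (μ : Measure (MarkovShift A)) [IsProbabilityMeasure μ] (hAtom : ∀ y, μ {y} = 0)
    (φ : MarkovShift A → ℝ) (P : ℝ) (K : ℕ → ℝ) (c : I → ℝ)
    -- `μ` is a mixing local weak `σ`-Gibbs measure with potential `φ`
    (hGibbs : IsLocalWeakGibbs μ φ P K c)
    (hInv : MeasurePreserving shift μ μ)
    (hMix : IsMixing μ)
    -- summable variations and integrability of the potential
    (hVar : ∑' n : ℕ, variation φ (n + 1) < ⊤)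
    (hInt : Integrable φ μ)
    -- the target: the cylinder `C(N, x)`, the radii `ℓ` and the centre `w`
    (N : ℕ) (x : MarkovShift A) (ℓ : ℕ → ℕ) (w : MarkovShift A)
    (hw : IsHittingPoint c w)
    -- the extra conditions in the genuinely weak case `sup K_n = ∞`
    (hℓ : ¬ BddAbove (Set.range K) →
      limsup (fun n : ℕ => (((ℓ n : ℝ) / n : ℝ) : EReal)) atTop < ⊤)
    (hφ : Infinite I → ¬ BddAbove (Set.range K) → BddAbove (Set.range φ))
    -- the upper rate `s̄` is finite
    (s : ℝ)
    (hs : limsup (fun n : ℕ =>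
      ((1 / (n : ℝ) * Real.log (1 / μ.real (cyl (ℓ n) w)) : ℝ) : EReal)) atTop = (s : EReal)) :
    ∃ PG : ℝ, IsGurevichPressure φ (PG : EReal) ∧
      ENNReal.ofReal ((PG - ∫ z, φ z ∂μ) / (PG - ∫ z, φ z ∂μ + s)) ≤
        measureDim μ (targetSet (cyl N x) ℓ w) := by
  have hs0 : 0 ≤ s := by
    have h0 : (0 : EReal) ≤ (s : EReal) := by
      rw [← hs]
      refine le_limsup_of_frequently_le (Frequently.of_forall fun n => ?_)
      have h1 : (0 : ℝ) ≤ 1 / (n : ℝ) * Real.log (1 / μ.real (cyl (ℓ n) w)) := by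
        refine mul_nonneg (by positivity) ?_
        rw [one_div, Real.log_inv]
        exact neg_nonneg.2 (Real.log_nonpos measureReal_nonneg measureReal_le_one)
      exact_mod_cast h1
    exact_mod_cast h0
  have hH := hGibbs.integral_le hInv hMix hInt x
  refine ⟨P, hGibbs.isGurevichPressure hVar hMix hA, le_measureDim_of_forall_not_subset ?_⟩
  intro α hα0 hα
  -- If the denominator vanished, the quotient would be `0` by convention and no `α ≥ 0` would lie
  -- below it.
  have hHs : 0 < P - ∫ z, φ z ∂μ + s := by
    rcases (by linarith : 0 ≤ P - ∫ z, φ z ∂μ + s).eq_or_lt with h0 | h0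
    · rw [← h0, div_zero] at hα
      linarith
    · exact h0
  have hα1 : α ≤ 1 := hα.le.trans ((div_le_one hHs).2 (by linarith))
  refine ⟨μ (cyl 0 w) / 2 * μ (cyl N x) ^ α, ?_, fun S hS hsum =>
    not_targetSet_subset_of_step hGibbs.pos hα0 hα1 ?_
      (fun m v _ _ => hGibbs.exists_step hInv hMix hInt hℓ hs hα0 hα1 ((lt_div_iff₀ hHs).1 hα) m v)
      hS hsum⟩
  · exact ENNReal.mul_pos (ENNReal.half_pos (hGibbs.pos 0 w).ne').ne'
      (ENNReal.rpow_pos (hGibbs.pos N x) (measure_ne_top _ _)).ne'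
  · exact ENNReal.half_le_self.trans prob_le_one
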